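/- All graphs are finite and simple, with vertex set $\{1,\dots,n\}$; $N[v]$ is the closed neighborhood of $v$. An ordering $\alpha=\langle v_1,\dots,v_n\rangle$ of the vertices of $G$ is a \emph{strong elimination ordering} if for all $i<j$ and $k<l$, $v_k,v_l\in N[v_i]$ and $v_k\in N[v_j]$ imply $v_l\in N[v_j]$; $G$ is \emph{strongly chordal} if it has such an ordering. The neighborhood matrix $M(G)$ based on $\alpha$ is the $n\times n$ matrix with $(i,j)$ entry $1$ if $v_i\in N[v_j]$ and $0$ otherwise. A matrix contains $\Delta=\begin{bmatrix}1&1\\1&0\end{bmatrix}$ if there are rows $a<b$ and columns $c<d$ whose entries form $\Delta$. A $0$-$1$ matrix is \emph{totally balanced} if no submatrix is (up to the order of rows and columns) the edge-vertex incidence matrix of a cycle of length at least $3$. \emph{Algorithm Insert-Query$(u,v)$.} Let $i,j$ be the positions of $u,v$ in $\alpha$. If $M[i][j]=1$, return False. Otherwise perform the following three searches, where entries outside the matrix read as $0$, and return False as soon as one of them succeeds; if none does, return True. (downward) for $l=j,\dots,n$ and $k=i,\dots,n$: $M[i][l+1]=1$, $M[k+1][j]=1$, $M[k+1][l+1]=0$;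 (upward) for $l=j,\dots,n$ and $k=i,i-1,\dots,1$: $M[k-1][j]=1$, $M[k-1][l+1]=1$, $M[i][l+1]=0$; (leftward) for $l=j,j-1,\dots,1$ and $k=i,\dots,n$: $M[i][l-1]=1$, $M[k+1][l-1]=1$, $M[k+1][j]=0$. \emph{Algorithm Insert$(u,v)$.} Call Insert-Query$(u,v)$; if it returns True, set $M[i][j]$ and $M[j][i]$ to $1$. Time is the number of elementary steps on a random access machine with two-dimensional arrays whose only arithmetic operations are successor and truncated predecessor. Then the following hold. 1. For every graph $G$ and ordering $\alpha$, $\alpha$ is a strong elimination ordering of $G$ if and only if the matrix $M(G)$ based on $\alpha$ does not contain $\Delta$. 2. (Farber) For every graph $G$ and every ordering of its vertices, $G$ is strongly chordal if and only if $M(G)$ is totally balanced. 3. Let $G$ be a graph with an ordering $\alpha$ and let $u\ne v$ be vertices at positions $i$ and $j$. Setting the entries $(i,j)$ and $(j,i)$ of $M(G)$ to $1$ yields the matrix $M(G+\{u,v\})$ based on $\alpha$. If this matrix does not contain $\Delta$, then $\alpha$ is a strong elimination ordering of $G+\{u,v\}$, so that $G+\{u,v\}$ is strongly chordal. 4. (Preprocessing)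 There is a single program which, given the adjacency matrix of any strongly chordal graph $G$ on $n$ vertices, computes a strong elimination ordering $\alpha$ of $G$, the inverse of $\alpha$, and the matrix $M(G)$ based on $\alpha$, in $O(n^3)$ time. 5. (Insertion) Let $\alpha$ be a strong elimination ordering of $G$, let $\alpha$, its inverse and the matrix $M(G)$ based on $\alpha$ be in memory, and let $u\neq v$ be vertices of $G$. Then Insert-Query$(u,v)$ halts in $O(n^2)$ time with the stored data unchanged; it returns True if $\{u,v\}$ is not an edge of $G$ and setting the entries $(i,j)$ and $(j,i)$ of $M(G)$ to $1$ creates no $\Delta$, and False otherwise. The remaining part of Insert$(u,v)$, the update of the matrix, takes $O(1)$ time. If the answer is True, then $\alpha$ is a strong elimination ordering of $G+\{u,v\}$, this graph is strongly chordal, and after the update the memory holds $\alpha$, its inverse and the matrix $M(G+\{u,v\})$; if the answer is False, it still holds $\alpha$, its inverse and $M(G)$. All implied constants are absolute. -/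

import Mathlib

namespace SCG

/-! ## Graphs and matrices -/

/-- The closed neighbourhood `N[v]`. -/
def closedNbhd {V : Type*} (G : SimpleGraph V) (v : V) : Set V :=
  insert v (G.neighborSet v)

/-- `α = ⟨v₀, …, vₙ₋₁⟩` is a strong elimination ordering of `G`: whenever `i < j`, `k < l`,
`v_k, v_l ∈ N[v_i]` and `v_k ∈ N[v_j]`, also `v_l ∈ N[v_j]`. -/
def IsStrongElimOrdering {V : Type*} {n : ℕ} (G : SimpleGraph V) (α : Fin n ≃ V) : Prop :=
  ∀ i j k l : Fin n, i < j → k < l →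
    α k ∈ closedNbhd G (α i) → α l ∈ closedNbhd G (α i) → α k ∈ closedNbhd G (α j) →
      α l ∈ closedNbhd G (α j)

/-- A (finite) graph is strongly chordal if it has a strong elimination ordering. -/
def IsStronglyChordal {V : Type*} (G : SimpleGraph V) : Prop :=
  ∃ (n : ℕ) (α : Fin n ≃ V), IsStrongElimOrdering G α

open Classical in
/-- The neighbourhood matrix `M(G)` based on `α`: the `(i, j)` entry is `1` if
`v_i ∈ N[v_j]` and `0` otherwise. -/
noncomputable def nbhdMatrix {V : Type*} {n : ℕ} (G : SimpleGraph V) (α : Fin n ≃ V) :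
    Matrix (Fin n) (Fin n) ℕ :=
  Matrix.of fun i j => if α i ∈ closedNbhd G (α j) then 1 else 0

/-- `M` contains `Δ = [[1, 1], [1, 0]]` as a submatrix (rows `a < b`, columns `c < d`). -/
def HasDelta {n : ℕ} (M : Matrix (Fin n) (Fin n) ℕ) : Prop :=
  ∃ a b c d : Fin n, a < b ∧ c < d ∧ M a c = 1 ∧ M a d = 1 ∧ M b c = 1 ∧ M b d = 0

/-- A `0`-`1` matrix is totally balanced if no submatrix of it is, up to the order of its rows
and columns, the edge-vertex incidence matrix of a cycle of length `k ≥ 3`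
(the `a`-th edge of the cycle joins the vertex `a` to its cyclic successor). -/
def IsTotallyBalanced {m n : Type*} (M : Matrix m n ℕ) : Prop :=
  ∀ (k : ℕ) (r : Fin k ↪ m) (c : Fin k ↪ n), 3 ≤ k →
    ¬ ∀ a b : Fin k, M (r a) (c b) = if b = a ∨ b = finRotate k a then 1 else 0

/-- The matrix obtained from `M` by setting the entries `(i, j)` and `(j, i)` to `1`. -/
def setEntry {n : ℕ} (M : Matrix (Fin n) (Fin n) ℕ) (i j : Fin n) :
    Matrix (Fin n) (Fin n) ℕ :=
  Matrix.of fun a b => if (a = i ∧ b = j) ∨ (a = j ∧ b = i) then 1 else M a b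

/-! ## The machine model

A random access machine with natural number registers and two-dimensional arrays, programmed in
a small structured language. The only arithmetic operations are successor and (truncated)
predecessor, so a value exceeds the input values and the literals of the program by at most the
number of steps made (polynomial running time means `O(log n)`-bit words). The cost of a run is the number of elementary operations: each node of each expression or test that is
evaluated, each assignment, and each store counts as one step. -/

/-- The memory: registers `x` and array cells `A[i][j]` (the arrays are numbered, too). -/
structure State where
  reg : ℕ → ℕ
  arr : ℕ → ℕ → ℕ → ℕ

/-- `x := w` -/
def State.setReg (s : State) (x w : ℕ) : State :=
  { s with reg := Function.update s.reg x w }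

/-- `A[i][j] := w` -/
def State.setArr (s : State) (A i j w : ℕ) : State :=
  { s with arr := fun B a b => if B = A ∧ a = i ∧ b = j then w else s.arr B a b }

/-- Expressions; `get A e f` is the array access `A[e][f]`. -/
inductive Expr where
  | lit (w : ℕ)
  | var (x : ℕ)
  | succ (e : Expr)
  | pred (e : Expr)
  | get (A : ℕ) (e f : Expr)

def Expr.eval (s : State) : Expr → ℕ
  | .lit w => w
  | .var x => s.reg x
  | .succ e => e.eval s + 1
  | .pred e => e.eval s - 1
  | .get A e f => s.arr A (e.eval s) (f.eval s)

def Expr.cost : Expr → ℕ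
  | .lit _ => 1
  | .var _ => 1
  | .succ e => e.cost + 1
  | .pred e => e.cost + 1
  | .get _ e f => e.cost + f.cost + 1

/-- Boolean tests. -/
inductive Test where
  | eq (e f : Expr)
  | le (e f : Expr)
  | neg (b : Test)
  | conj (b c : Test)

def Test.holds (s : State) : Test → Prop
  | .eq e f => e.eval s = f.eval s
  | .le e f => e.eval s ≤ f.eval s
  | .neg b => ¬ b.holds s
  | .conj b c => b.holds s ∧ c.holds s

def Test.cost : Test → ℕ
  | .eq e f => e.cost + f.cost + 1
  | .le e f => e.cost + f.cost + 1
  | .neg b => b.cost + 1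
  | .conj b c => b.cost + c.cost + 1

/-- Programs. -/
inductive Prog where
  | skip
  | assign (x : ℕ) (e : Expr)
  | store (A : ℕ) (e f g : Expr)
  | seq (p q : Prog)
  | branch (b : Test) (p q : Prog)
  | loop (b : Test) (p : Prog)

/-- `Exec p s t s'`: started in the memory state `s`, the program `p` halts after `t` steps in the
memory state `s'`. -/
inductive Exec : Prog → State → ℕ → State → Prop
  | skip (s : State) : Exec .skip s 1 s
  | assign (s : State) (x : ℕ) (e : Expr) :
      Exec (.assign x e) s (e.cost + 1) (s.setReg x (e.eval s))
  | store (s : State) (A : ℕ) (e f g : Expr) :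
      Exec (.store A e f g) s (e.cost + f.cost + g.cost + 1)
        (s.setArr A (e.eval s) (f.eval s) (g.eval s))
  | seq {s s' s'' : State} {p q : Prog} {t t' : ℕ} :
      Exec p s t s' → Exec q s' t' s'' → Exec (.seq p q) s (t + t') s''
  | branch_true {s s' : State} {b : Test} {p q : Prog} {t : ℕ} :
      b.holds s → Exec p s t s' → Exec (.branch b p q) s (b.cost + t) s'
  | branch_false {s s' : State} {b : Test} {p q : Prog} {t : ℕ} :
      ¬ b.holds s → Exec q s t s' → Exec (.branch b p q) s (b.cost + t) s'
  | loop_true {s s' s'' : State} {b : Test} {p : Prog} {t t' : ℕ} :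
      b.holds s → Exec p s t s' → Exec (.loop b p) s' t' s'' →
        Exec (.loop b p) s (b.cost + t + t') s''
  | loop_false {s : State} {b : Test} {p : Prog} :
      ¬ b.holds s → Exec (.loop b p) s b.cost s

/-! ## Memory layout -/

/-- The register that holds the number `n` of vertices. -/
abbrev regN : ℕ := 0
/-- The registers that hold the end vertices of the edge to be inserted. -/
abbrev regU : ℕ := 1
abbrev regV : ℕ := 2
/-- The register for `canBeInserted` (`1` is True, `0` is False). -/
abbrev regCan : ℕ := 3
abbrev regI : ℕ := 4
abbrev regJ : ℕ := 5
abbrev regK : ℕ := 6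
abbrev regL : ℕ := 7

/-- The input array: the adjacency matrix of the graph. -/
abbrev arrAdj : ℕ := 0
/-- The neighbourhood matrix. -/
abbrev arrM : ℕ := 1
/-- The ordering `α` (in row `0`): the `i`-th cell holds the `i`-th vertex. -/
abbrev arrOrd : ℕ := 2
/-- The inverse of `α` (in row `0`): the `v`-th cell holds the position of the vertex `v`. -/
abbrev arrPos : ℕ := 3

open Classical in
/-- The input of the preprocessing: `n` and the adjacency matrix of `G`. Vertices and positions are
numbered from `1` to `n` in the machine. All the rest of the memory is `0`. -/
noncomputable def inputState {n : ℕ} (G : SimpleGraph (Fin n)) : State where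
  reg := fun x => if x = regN then n else 0
  arr := fun A a b =>
    if A = arrAdj ∧ ∃ u v : Fin n, G.Adj u v ∧ a = u.val + 1 ∧ b = v.val + 1 then 1 else 0

/-- The memory holds `n`, the ordering `α`, its inverse, and the neighbourhood matrix `M(G)` based on
`α`, with rows and columns `1, …, n`, surrounded by cells with value `0`. -/
def Represents {n : ℕ} (G : SimpleGraph (Fin n)) (α : Fin n ≃ Fin n) (s : State) : Prop :=
  s.reg regN = n ∧
  (∀ i : Fin n, s.arr arrOrd 0 (i.val + 1) = (α i).val + 1) ∧
  (∀ v : Fin n, s.arr arrPos 0 (v.val + 1) = (α.symm v).val + 1) ∧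
  (∀ i j : Fin n, s.arr arrM (i.val + 1) (j.val + 1) = nbhdMatrix G α i j) ∧
  (∀ a b : ℕ, a = 0 ∨ n < a ∨ b = 0 ∨ n < b → s.arr arrM a b = 0)

/-! ## The algorithms -/

/-- `M[e][f] == w` -/
def entryIs (e f : Expr) (w : ℕ) : Test := .eq (.get arrM e f) (.lit w)

/-- `for x ← e to n do p`; the loop is left as soon as `canBeInserted` is False, which is the effect
of an early `return`. -/
def forUp (x : ℕ) (e : Expr) (p : Prog) : Prog :=
  .seq (.assign x e)
    (.loop (.conj (.le (.var x) (.var regN)) (.eq (.var regCan) (.lit 1)))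
      (.seq p (.assign x (.succ (.var x)))))

/-- `for x ← e down to 1 do p`, with the same early `return`. -/
def forDown (x : ℕ) (e : Expr) (p : Prog) : Prog :=
  .seq (.assign x e)
    (.loop (.conj (.le (.lit 1) (.var x)) (.eq (.var regCan) (.lit 1)))
      (.seq p (.assign x (.pred (.var x)))))

/-- `if b then canBeInserted ← False` -/
def rejectIf (b : Test) : Prog := .branch b (.assign regCan (.lit 0)) .skip

/-- Downward search: is `(i, j)` the upper left entry of a new `Δ`? -/
def searchDown : Prog :=
  forUp regL (.var regJ) <| forUp regK (.var regI) <| rejectIf <|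
    .conj (entryIs (.var regI) (.succ (.var regL)) 1) <|
    .conj (entryIs (.succ (.var regK)) (.var regJ) 1)
      (entryIs (.succ (.var regK)) (.succ (.var regL)) 0)

/-- Upward search: is `(i, j)` the lower left entry of a new `Δ`? -/
def searchUp : Prog :=
  forUp regL (.var regJ) <| forDown regK (.var regI) <| rejectIf <|
    .conj (entryIs (.pred (.var regK)) (.var regJ) 1) <|
    .conj (entryIs (.pred (.var regK)) (.succ (.var regL)) 1)
      (entryIs (.var regI) (.succ (.var regL)) 0)

/-- Leftward search: is `(i, j)` the upper right entry of a new `Δ`? -/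
def searchLeft : Prog :=
  forDown regL (.var regJ) <| forUp regK (.var regI) <| rejectIf <|
    .conj (entryIs (.var regI) (.pred (.var regL)) 1) <|
    .conj (entryIs (.succ (.var regK)) (.pred (.var regL)) 1)
      (entryIs (.succ (.var regK)) (.var regJ) 0)

/-- Insert-Query: find the positions `i`, `j` of `u`, `v`, answer False if `{u, v}` is an edge
already, and search for a `Δ` in the three directions otherwise. -/
def insertQuery : Prog :=
  .seq (.assign regCan (.lit 1)) <|
  .seq (.assign regI (.get arrPos (.lit 0) (.var regU))) <|
  .seq (.assign regJ (.get arrPos (.lit 0) (.var regV))) <|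
  .branch (entryIs (.var regI) (.var regJ) 1) (.assign regCan (.lit 0)) <|
  .seq searchDown (.seq searchUp searchLeft)

/-- If the answer of Insert-Query is True, insert the edge: set the entries `(i, j)` and `(j, i)` of
the neighbourhood matrix to `1`. -/
def updateMatrix : Prog :=
  .branch (.eq (.var regCan) (.lit 1))
    (.seq (.store arrM (.var regI) (.var regJ) (.lit 1))
      (.store arrM (.var regJ) (.var regI) (.lit 1)))
    .skip

/-- Insert: a call of Insert-Query, followed by the update of the matrix. -/
def insertEdge : Prog := .seq insertQuery updateMatrix

end SCG

/-!
Strong elimination orderings are the orderings without `Δ` by definition, up to the symmetry of the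
neighbourhood matrix.

*Farber's theorem.* If `α` is a strong elimination ordering and the matrix contained a cycle, the
row of the cycle which comes first in `α` would force a third one into another row of the cycle
(`isTotallyBalanced_of_isStronglyChordal`). Conversely, order the vertices such that the sum of
`2 ^ (i + j)` over the ones `(i, j)` of the matrix is as large as possible. Then the rows, read as
binary numbers, do not decrease (`exists_doublyLexical_ordering`), since otherwise the exchange of
two vertices would increase this quadratic form. In such an ordering a `Δ` can be extended, one row
and one column at a time, to a zigzag of ones whose ends can only be joined by closing a cycle
(`exists_zigzag`). In a totally balanced matrix the extension would never end, so there is no `Δ`.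

*Preprocessing.* The vertices are eliminated one by one. In each round a list of the remaining
vertices is stably sorted by degree, and its first simple vertex is eliminated; there is one, because
the first vertex of any set in a strong elimination ordering is simple in the graph induced on this
set (`hasSimpleVertices_reflAdj`). Stability guarantees that `y` precedes `x` in the list as soon as
the neighbourhood of `y` has been properly contained in that of `x` at some time (`pairwise_queue`),
and this makes the order of elimination a strong elimination ordering (`pick_strong`). The program
maintains the numbers `|N[x] \ N[y]|`, where `y = 0` gives the degrees. With them, sorting the list,
testing all vertices for being simple, and removing a vertex take time `O(n²)` each, because in the
sorted list only consecutive neighbours of a vertex have to be compared (`isSimple_iff_isChain`).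

*Insertion.* A new `Δ` uses exactly one of the entries `(i, j)` and `(j, i)`, as one of its ones. By
symmetry it may be assumed to be `(i, j)`, and the three searches correspond to the three places
which `(i, j)` can take in the `Δ` (`hasDelta_setEntry_iff`).

Programs are verified with the rules of a Hoare logic for total correctness with time bounds
(`Runs`). The frame conditions come from the syntax (`Preserves`): a program changes only the
registers and arrays which it mentions as targets.
-/

namespace SCG

/-! ### Neighbourhood matrices, strong elimination orderings, and edge insertion -/

theorem mem_closedNbhd {V : Type*} {G : SimpleGraph V} {u v : V} :
    u ∈ closedNbhd G v ↔ u = v ∨ G.Adj v u := by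
  simp [closedNbhd]

theorem mem_closedNbhd_comm {V : Type*} {G : SimpleGraph V} {u v : V} :
    u ∈ closedNbhd G v ↔ v ∈ closedNbhd G u := by
  rw [mem_closedNbhd, mem_closedNbhd, eq_comm, G.adj_comm]

theorem nbhdMatrix_eq_one {V : Type*} {n : ℕ} {G : SimpleGraph V} {α : Fin n ≃ V} {i j : Fin n} :
    nbhdMatrix G α i j = 1 ↔ α i ∈ closedNbhd G (α j) := by
  simp [nbhdMatrix]

theorem nbhdMatrix_eq_zero {V : Type*} {n : ℕ} {G : SimpleGraph V} {α : Fin n ≃ V} {i j : Fin n} :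
    nbhdMatrix G α i j = 0 ↔ α i ∉ closedNbhd G (α j) := by
  simp [nbhdMatrix]

theorem nbhdMatrix_comm {V : Type*} {n : ℕ} {G : SimpleGraph V} {α : Fin n ≃ V} {i j : Fin n} :
    nbhdMatrix G α i j = nbhdMatrix G α j i := by
  simp only [nbhdMatrix, Matrix.of_apply]
  congr 1
  exact propext mem_closedNbhd_comm

theorem isStrongElimOrdering_iff_not_hasDelta {V : Type*} {n : ℕ} {G : SimpleGraph V}
    {α : Fin n ≃ V} : IsStrongElimOrdering G α ↔ ¬ HasDelta (nbhdMatrix G α) := by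
  simp only [HasDelta, nbhdMatrix_eq_one, nbhdMatrix_eq_zero, IsStrongElimOrdering]
  constructor
  · rintro h ⟨a, b, c, d, hab, hcd, h1, h2, h3, h4⟩
    rw [mem_closedNbhd_comm] at h1 h2 h3 h4
    exact h4 (h a b c d hab hcd h1 h2 h3)
  · intro h i j k l hij hkl h1 h2 h3
    by_contra h4
    rw [mem_closedNbhd_comm] at h1 h2 h3 h4
    exact h ⟨i, j, k, l, hij, hkl, h1, h2, h3, h4⟩

theorem nbhdMatrix_sup_edge {V : Type*} {n : ℕ} (G : SimpleGraph V) (α : Fin n ≃ V) {u v : V}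
    (huv : u ≠ v) :
    nbhdMatrix (G ⊔ SimpleGraph.edge u v) α =
      setEntry (nbhdMatrix G α) (α.symm u) (α.symm v) := by
  classical
  ext a b
  have key : α a ∈ closedNbhd (G ⊔ SimpleGraph.edge u v) (α b) ↔
      ((a = α.symm u ∧ b = α.symm v) ∨ (a = α.symm v ∧ b = α.symm u)) ∨
        α a ∈ closedNbhd G (α b) := by
    simp only [mem_closedNbhd, SimpleGraph.sup_adj, SimpleGraph.edge_adj, Equiv.eq_symm_apply]
    grind
  simp only [setEntry, nbhdMatrix, Matrix.of_apply, key]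
  split_ifs <;> tauto

theorem isStrongElimOrdering_sup_edge {V : Type*} {n : ℕ} {G : SimpleGraph V} {α : Fin n ≃ V}
    {u v : V} (huv : u ≠ v)
    (h : ¬ HasDelta (setEntry (nbhdMatrix G α) (α.symm u) (α.symm v))) :
    IsStrongElimOrdering (G ⊔ SimpleGraph.edge u v) α := by
  rwa [isStrongElimOrdering_iff_not_hasDelta, nbhdMatrix_sup_edge G α huv]

/-! ### Strongly chordal graphs have totally balanced neighbourhood matrices -/

theorem finRotate_ne_self {k : ℕ} (hk : 3 ≤ k) (a : Fin k) : finRotate k a ≠ a := by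
  obtain ⟨m, rfl⟩ := Nat.exists_eq_add_of_le' hk
  simp

theorem finRotate_finRotate_ne_self {k : ℕ} (hk : 3 ≤ k) (a : Fin k) :
    finRotate k (finRotate k a) ≠ a := by
  obtain ⟨m, rfl⟩ := Nat.exists_eq_add_of_le' hk
  intro h
  have h' := congrArg Fin.val h
  simp only [coe_finRotate, Fin.ext_iff, Fin.val_last] at h'
  have := a.isLt
  grind

theorem isTotallyBalanced_of_isStronglyChordal {V : Type*} {n : ℕ} {G : SimpleGraph V}
    (α : Fin n ≃ V) (hG : IsStronglyChordal G) : IsTotallyBalanced (nbhdMatrix G α) := by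
  obtain ⟨m, β, hβ⟩ := hG
  intro k r c hk h
  set f : Fin k → Fin m := fun a => β.symm (α (r a)) with hf
  set g : Fin k → Fin m := fun a => β.symm (α (c a)) with hg
  have hfinj : Function.Injective f := fun a b hab => by simpa [hf] using hab
  have hginj : Function.Injective g := fun a b hab => by simpa [hg] using hab
  have E : ∀ a b, β (f a) ∈ closedNbhd G (β (g b)) ↔ b = a ∨ b = finRotate k a := by
    intro a b
    have := h a b
    simp only [hf, hg, Equiv.apply_symm_apply, ← nbhdMatrix_eq_one, this]
    split_ifs <;> simp_all
  have E' : ∀ a b, β (g b) ∈ closedNbhd G (β (f a)) ↔ b = a ∨ b = finRotate k a := by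
    intro a b; rw [mem_closedNbhd_comm, E]
  have : Nonempty (Fin k) := ⟨⟨0, by omega⟩⟩
  -- Of all rows of the cycle, `a` comes first in the strong elimination ordering.
  obtain ⟨a, ha⟩ := Finite.exists_min f
  have hlt : ∀ b, b ≠ a → f a < f b := fun b hb =>
    lt_of_le_of_ne (ha b) fun e => hb (hfinj e).symm
  have h1 := finRotate_ne_self hk
  have h2 := finRotate_finRotate_ne_self hk
  rcases lt_trichotomy (g a) (g (finRotate k a)) with hlt' | heq | hgt
  · set b := (finRotate k).symm a with hb
    have hba : finRotate k b = a := Equiv.apply_symm_apply _ _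
    have hne : b ≠ a := fun e => h1 b (by rw [hba, e])
    have := hβ (f a) (f b) _ _ (hlt b hne) hlt' ((E' _ _).2 (Or.inl rfl)) ((E' _ _).2 (Or.inr rfl))
      ((E' _ _).2 (Or.inr hba.symm))
    rw [E', hba] at this
    rcases this with h' | h'
    · exact h2 b (by rw [hba, h'])
    · exact h1 a h'
  · exact h1 a (hginj heq).symm
  · have := hβ (f a) (f (finRotate k a)) _ _ (hlt _ (h1 a)) hgt ((E' _ _).2 (Or.inr rfl))
      ((E' _ _).2 (Or.inl rfl)) ((E' _ _).2 (Or.inl rfl))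
    rw [E'] at this
    rcases this with h' | h'
    · exact h1 a h'.symm
    · exact h2 a h'.symm

/-! ### Doubly lexical orderings -/

/-- If the characteristic vector of `s`, read as a binary number, is at most that of `t`, then at
the last position where they differ it is `t` that has the one. -/
theorem exists_last_difference {n : ℕ} {s t : Finset (Fin n)}
    (h : ∑ j ∈ s, 2 ^ (j : ℕ) ≤ ∑ j ∈ t, 2 ^ (j : ℕ)) {d : Fin n} (hs : d ∈ s) (ht : d ∉ t) :
    ∃ d', d < d' ∧ d' ∉ s ∧ d' ∈ t ∧ ∀ e, d' < e → (e ∈ s ↔ e ∈ t) := by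
  classical
  have h' : ∑ j ∈ s.image Fin.val, 2 ^ j ≤ ∑ j ∈ t.image Fin.val, 2 ^ j := by
    rwa [Finset.sum_image (Fin.val_injective.injOn), Finset.sum_image (Fin.val_injective.injOn)]
  rw [Finset.geomSum_le_geomSum_iff_toColex_le_toColex le_rfl,
    Finset.Colex.toColex_image_le_toColex_image Fin.val_strictMono,
    Finset.Colex.toColex_le_toColex_iff_max'_mem] at h'
  have hst : s ≠ t := fun e => ht (e ▸ hs)
  have hm := h' hst
  set m := (symmDiff s t).max' (Finset.symmDiff_nonempty.2 hst) with hmdef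
  have hm' : m ∈ symmDiff s t := Finset.max'_mem _ _
  have hms : m ∉ s := by
    rw [Finset.mem_symmDiff] at hm'; tauto
  have hdm : d ≤ m := Finset.le_max' _ _ (by rw [Finset.mem_symmDiff]; tauto)
  refine ⟨m, lt_of_le_of_ne hdm fun e => hms (e ▸ hs), hms, hm, fun e he => ?_⟩
  by_contra hne
  have : e ≤ m := Finset.le_max' _ _ (by rw [Finset.mem_symmDiff]; tauto)
  exact absurd he (not_lt.2 this)

/-- Moving weight from `y` to `x` increases a quadratic form if the form's gradient is larger
at `x`. -/
theorem quadraticForm_lt_of_shift {V : Type*} [Fintype V] [DecidableEq V] {A : Matrix V V ℤ}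
    (hA : A.transpose = A) {x y : V} (hx : A x x = 1) (hy : A y y = 1) (hxy : A x y ≤ 1)
    {w : V → ℤ} {δ : ℤ} (hδ : 0 < δ) (hw : A.mulVec w y < A.mulVec w x) :
    w ⬝ᵥ A.mulVec w <
      (w + δ • (Pi.single x 1 - Pi.single y 1)) ⬝ᵥ
        A.mulVec (w + δ • (Pi.single x 1 - Pi.single y 1)) := by
  set e : V → ℤ := Pi.single x 1 - Pi.single y 1 with he
  have h1 : e ⬝ᵥ A.mulVec w = A.mulVec w x - A.mulVec w y := by
    simp [he, sub_dotProduct]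
  have h2 : w ⬝ᵥ A.mulVec e = e ⬝ᵥ A.mulVec w := by
    rw [Matrix.dotProduct_mulVec, ← Matrix.mulVec_transpose, hA, dotProduct_comm]
  have hyx : A y x = A x y := by
    conv_lhs => rw [← hA]
    rfl
  have h3 : e ⬝ᵥ A.mulVec e = 2 - 2 * A x y := by
    simp [he, sub_dotProduct, Matrix.mulVec_sub, hx, hy, hyx]
    ring
  rw [Matrix.mulVec_add, Matrix.mulVec_smul, add_dotProduct, dotProduct_add, dotProduct_add,
    dotProduct_smul, smul_dotProduct, smul_dotProduct, dotProduct_smul, h2, h3, h1]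
  simp only [smul_eq_mul]
  nlinarith [mul_pos hδ (sub_pos.2 hw), mul_nonneg (mul_pos hδ hδ).le (sub_nonneg.2 hxy)]

open Classical in
/-- The positions of the closed neighbours of the `p`-th vertex. -/
noncomputable def nbhdPositions {V : Type*} {n : ℕ} (G : SimpleGraph V) (α : Fin n ≃ V)
    (p : Fin n) : Finset (Fin n) :=
  Finset.univ.filter fun j => α j ∈ closedNbhd G (α p)

theorem mem_nbhdPositions {V : Type*} {n : ℕ} {G : SimpleGraph V} {α : Fin n ≃ V}
    {p j : Fin n} : j ∈ nbhdPositions G α p ↔ α j ∈ closedNbhd G (α p) := by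
  simp [nbhdPositions]

/-- Every finite graph has an ordering for which the rows of the neighbourhood matrix, read as
binary numbers with the last column the most significant, do not decrease. -/
theorem exists_doublyLexical_ordering {V : Type*} {n : ℕ} (G : SimpleGraph V) (α₀ : Fin n ≃ V) :
    ∃ α : Fin n ≃ V, ∀ p q, p < q →
      ∑ j ∈ nbhdPositions G α p, 2 ^ (j : ℕ) ≤ ∑ j ∈ nbhdPositions G α q, 2 ^ (j : ℕ) := by
  classical
  have : Fintype V := Fintype.ofEquiv _ α₀
  set A : Matrix V V ℤ := Matrix.of fun u v => if v ∈ closedNbhd G u then 1 else 0 with hAdef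
  have hA : A.transpose = A := by
    ext u v
    simp only [hAdef, Matrix.transpose_apply, Matrix.of_apply, mem_closedNbhd_comm]
  set W : (Fin n ≃ V) → V → ℤ := fun α v => 2 ^ (α.symm v : ℕ) with hW
  have : Nonempty (Fin n ≃ V) := ⟨α₀⟩
  -- The sum of `2 ^ (i + j)` over the ones `(i, j)` of the matrix is to be as large as possible.
  obtain ⟨α, hα⟩ := Finite.exists_max fun α => W α ⬝ᵥ A.mulVec (W α)
  refine ⟨α, fun p q hpq => ?_⟩
  by_contra! hlt
  have hrow : ∀ p, A.mulVec (W α) (α p) =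
      ((∑ j ∈ nbhdPositions G α p, 2 ^ (j : ℕ) : ℕ) : ℤ) := by
    intro p
    simp only [Matrix.mulVec, dotProduct, nbhdPositions, hAdef, Matrix.of_apply, ite_mul, one_mul,
      zero_mul, Finset.sum_filter]
    rw [← α.sum_comp]
    push_cast
    simp [hW]
  have hshift : W ((Equiv.swap p q).trans α) =
      W α + ((2 : ℤ) ^ (q : ℕ) - 2 ^ (p : ℕ)) • (Pi.single (α p) 1 - Pi.single (α q) 1) := by
    ext v
    obtain ⟨r, rfl⟩ := α.surjective v
    simp only [hW, Equiv.symm_trans_apply, Equiv.symm_apply_apply, Equiv.symm_swap, Pi.add_apply,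
      Pi.smul_apply, Pi.sub_apply, Pi.single_apply, EmbeddingLike.apply_eq_iff_eq, smul_eq_mul]
    by_cases hp : r = p
    · subst hp; simp [hpq.ne]
    by_cases hq : r = q
    · subst hq; simp [hpq.ne']
    simp [Equiv.swap_apply_of_ne_of_ne hp hq, hp, hq]
  have hself : ∀ v, A v v = 1 := fun v => by simp [hAdef, mem_closedNbhd]
  have hle : ∀ u v, A u v ≤ 1 := fun u v => by
    simp only [hAdef, Matrix.of_apply]; split_ifs <;> simp
  have hpow : (0 : ℤ) < 2 ^ (q : ℕ) - 2 ^ (p : ℕ) :=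
    sub_pos.2 (pow_lt_pow_right₀ (by norm_num) hpq)
  have := quadraticForm_lt_of_shift hA (hself (α p)) (hself (α q)) (hle _ _) (w := W α) hpow
    (by rw [hrow, hrow]; exact_mod_cast hlt)
  rw [← hshift] at this
  exact absurd this (not_lt.2 (hα _))

/-! ### Totally balanced neighbourhood matrices come from strongly chordal graphs -/

/-- Rows `r 0, …, r m` and columns `c 0, …, c m` meet in ones exactly at `(0, 0)` and next to the
diagonal: the ones form a path whose ends are the row and the column with index `m`. -/
def IsZigzag {n : ℕ} (R : Fin n → Fin n → Prop) (m : ℕ) (r c : ℕ → Fin n) : Prop :=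
  ∀ i j, i ≤ m → j ≤ m → (R (r i) (c j) ↔ (i = 0 ∧ j = 0) ∨ i = j + 1 ∨ j = i + 1)

/-- A zigzag which is closed by a one at its two ends is, after a reordering of the rows and
columns, the incidence matrix of a cycle. -/
theorem exists_cycle_of_closed_zigzag {n K : ℕ} (hK : 2 ≤ K) {R : Fin n → Fin n → Prop}
    {r c : ℕ → Fin n} (hr : ∀ i j, i < j → j ≤ K → r i < r j)
    (hc : ∀ i j, i < j → j ≤ K → c i < c j)
    (hR : ∀ i j, i ≤ K → j ≤ K →
      (R (r i) (c j) ↔ (i = 0 ∧ j = 0) ∨ i = j + 1 ∨ j = i + 1 ∨ (i = K ∧ j = K))) :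
    ∃ r' c' : Fin (K + 1) ↪ Fin n,
      ∀ a b, R (r' a) (c' b) ↔ b = a ∨ b = finRotate (K + 1) a := by
  have inj : ∀ f : ℕ → Fin n, (∀ i j, i < j → j ≤ K → f i < f j) →
      ∀ i j, i ≤ K → j ≤ K → f i = f j → i = j := by
    intro f hf i j hi hj h
    rcases lt_trichotomy i j with h' | h' | h'
    · exact absurd h (hf i j h' hj).ne
    · exact h'
    · exact absurd h (hf j i h' hi).ne'
  -- Along the cycle the columns come in the order `0, 1, 3, 5, …, 6, 4, 2`,
  -- and the rows between them in the order `0, 2, 4, …, 5, 3, 1`.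
  let ir : ℕ → ℕ := fun a => if 2 * a ≤ K then 2 * a else 2 * (K + 1 - a) - 1
  let ic : ℕ → ℕ := fun a => if 2 * a ≤ K + 1 then 2 * a - 1 else 2 * (K + 1 - a)
  have hir : ∀ a, a ≤ K → ir a ≤ K := by intro a ha; simp only [ir]; split_ifs <;> omega
  have hic : ∀ a, a ≤ K → ic a ≤ K := by intro a ha; simp only [ic]; split_ifs <;> omega
  have hrinj : Function.Injective fun a : Fin (K + 1) => r (ir a) := fun a b hab => by
    have := inj r hr _ _ (hir a (by omega)) (hir b (by omega)) hab
    apply Fin.ext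
    simp only [ir] at this
    split_ifs at this <;> omega
  have hcinj : Function.Injective fun b : Fin (K + 1) => c (ic b) := fun a b hab => by
    have := inj c hc _ _ (hic a (by omega)) (hic b (by omega)) hab
    apply Fin.ext
    simp only [ic] at this
    split_ifs at this <;> omega
  refine ⟨⟨_, hrinj⟩, ⟨_, hcinj⟩, ?_⟩
  · intro a b
    simp only [Function.Embedding.coeFn_mk]
    rw [hR _ _ (hir a (by omega)) (hic b (by omega))]
    simp only [Fin.ext_iff, coe_finRotate, Fin.val_last]
    have := a.isLt
    have := b.isLt
    simp only [ir, ic]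
    split_ifs <;> omega

/-- Lubiw's argument: in a doubly lexical ordering without cycles, a zigzag can always be
extended, because the first of two rows which differ somewhere in the order `1, 0` must be
overtaken by the second further on. By the last two conditions, consecutive rows agree beyond the
last column in which they differ, so that a new column meets the earlier rows in zeros; likewise for
the columns. -/
theorem exists_zigzag {n : ℕ} {R : Fin n → Fin n → Prop} (hsymm : ∀ i j, R i j ↔ R j i)
    (hlex : ∀ p q d, p < q → R p d → ¬ R q d →
      ∃ d', d < d' ∧ ¬ R p d' ∧ R q d' ∧ ∀ e, d' < e → (R p e ↔ R q e))
    (hcycle : ∀ K, 2 ≤ K → ¬ ∃ r c : Fin (K + 1) ↪ Fin n,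
      ∀ a b, R (r a) (c b) ↔ b = a ∨ b = finRotate (K + 1) a)
    {a b c d : Fin n} (hab : a < b) (hcd : c < d) (hac : R a c) (had : R a d) (hbc : R b c)
    (hbd : ¬ R b d) (m : ℕ) :
    ∃ r c : ℕ → Fin n, (∀ i j, i < j → j ≤ m + 1 → r i < r j) ∧
      (∀ i j, i < j → j ≤ m + 1 → c i < c j) ∧ IsZigzag R (m + 1) r c ∧
      (∀ i, i + 2 ≤ m + 1 → ∀ e, c (i + 2) < e → (R (r i) e ↔ R (r (i + 1)) e)) ∧
      (∀ i, i + 2 ≤ m + 1 → ∀ e, r (i + 2) < e → (R e (c i) ↔ R e (c (i + 1)))) := by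
  induction m with
  | zero =>
    refine ⟨fun i => if i = 0 then a else b, fun i => if i = 0 then c else d, ?_, ?_, ?_, ?_, ?_⟩
    · intro i j hij hj
      obtain ⟨rfl, rfl⟩ : i = 0 ∧ j = 1 := by omega
      simpa
    · intro i j hij hj
      obtain ⟨rfl, rfl⟩ : i = 0 ∧ j = 1 := by omega
      simpa
    · intro i j hi hj
      interval_cases i <;> interval_cases j <;> simp [hac, had, hbc, hbd]
    · intro i hi; omega
    · intro i hi; omega
  | succ m ih =>
    obtain ⟨r, c, hr, hc, hz, hrr, hcc⟩ := ih
    have hlexc : ∀ p q d, p < q → R d p → ¬ R d q →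
        ∃ d', d < d' ∧ ¬ R d' p ∧ R d' q ∧ ∀ e, d' < e → (R e p ↔ R e q) := by
      intro p q d hpq h1 h2
      rw [hsymm] at h1 h2
      obtain ⟨d', h3, h4, h5, h6⟩ := hlex p q d hpq h1 h2
      exact ⟨d', h3, by rwa [hsymm], by rwa [hsymm], fun e he => by
        rw [hsymm e p, hsymm e q]; exact h6 e he⟩
    obtain ⟨c', hc1, hc2, hc3, hc4⟩ := hlex (r m) (r (m + 1)) (c (m + 1))
      (hr _ _ (by omega) le_rfl) ((hz _ _ (by omega) le_rfl).2 (by omega))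
      (by rw [hz _ _ le_rfl le_rfl]; omega)
    obtain ⟨r', hr1, hr2, hr3, hr4⟩ := hlexc (c m) (c (m + 1)) (r (m + 1))
      (hc _ _ (by omega) le_rfl) ((hz _ _ le_rfl (by omega)).2 (by omega))
      (by rw [hz _ _ le_rfl le_rfl]; omega)
    have hcle : ∀ i, i ≤ m + 1 → c i ≤ c (m + 1) := fun i hi => by
      rcases hi.lt_or_eq with h | rfl
      · exact (hc _ _ h le_rfl).le
      · exact le_rfl
    have hrle : ∀ i, i ≤ m + 1 → r i ≤ r (m + 1) := fun i hi => by
      rcases hi.lt_or_eq with h | rfl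
      · exact (hr _ _ h le_rfl).le
      · exact le_rfl
    -- Rows with smaller index agree beyond the columns chosen so far, so that they have a zero in
    -- the new column, too; likewise for the columns.
    have hrow : ∀ k i, i + k = m → ¬ R (r i) c' := by
      intro k
      induction k with
      | zero => rintro i rfl; exact hc2
      | succ k ihk =>
        intro i hi
        rw [hrr i (by omega) c' (lt_of_le_of_lt (hcle _ (by omega)) hc1)]
        exact ihk _ (by omega)
    have hcol : ∀ k i, i + k = m → ¬ R r' (c i) := by
      intro k
      induction k with
      | zero => rintro i rfl; exact hr2
      | succ k ihk =>
        intro i hi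
        rw [hcc i (by omega) r' (lt_of_le_of_lt (hrle _ (by omega)) hr1)]
        exact ihk _ (by omega)
    let r₁ : ℕ → Fin n := fun i => if i ≤ m + 1 then r i else r'
    let c₁ : ℕ → Fin n := fun i => if i ≤ m + 1 then c i else c'
    have hr₁ : ∀ i j, i < j → j ≤ m + 1 + 1 → r₁ i < r₁ j := by
      intro i j hij hj
      simp only [r₁, if_pos (show i ≤ m + 1 by omega)]
      split_ifs with h
      · exact hr i j hij h
      · exact lt_of_le_of_lt (hrle i (by omega)) hr1
    have hc₁ : ∀ i j, i < j → j ≤ m + 1 + 1 → c₁ i < c₁ j := by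
      intro i j hij hj
      simp only [c₁, if_pos (show i ≤ m + 1 by omega)]
      split_ifs with h
      · exact hc i j hij h
      · exact lt_of_le_of_lt (hcle i (by omega)) hc1
    have hpattern : ∀ i j, i ≤ m + 2 → j ≤ m + 2 → (i ≤ m + 1 ∨ j ≤ m + 1) →
        (R (r₁ i) (c₁ j) ↔ (i = 0 ∧ j = 0) ∨ i = j + 1 ∨ j = i + 1) := by
      intro i j hi hj hij
      simp only [r₁, c₁]
      split_ifs with h1 h2 h2
      · exact hz i j h1 h2
      · obtain rfl : j = m + 2 := by omega
        rcases h1.lt_or_eq with h | rfl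
        · have := hrow (m - i) i (by omega)
          simp only [this, false_iff]; omega
        · exact iff_of_true hc3 (by omega)
      · obtain rfl : i = m + 2 := by omega
        rcases h2.lt_or_eq with h | rfl
        · have := hcol (m - j) j (by omega)
          simp only [this, false_iff]; omega
        · exact iff_of_true hr3 (by omega)
      · omega
    have hr₁' : r₁ (m + 2) = r' := if_neg (by omega)
    have hc₁' : c₁ (m + 2) = c' := if_neg (by omega)
    have hopen : ¬ R r' c' := by
      intro hclosed
      refine hcycle (m + 2) (by omega) (exists_cycle_of_closed_zigzag (by omega) hr₁ hc₁ ?_)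
      intro i j hi hj
      by_cases h : i ≤ m + 1 ∨ j ≤ m + 1
      · rw [hpattern i j hi hj h]; omega
      · obtain ⟨rfl, rfl⟩ : i = m + 2 ∧ j = m + 2 := by omega
        rw [hr₁', hc₁']
        simp [hclosed]
    refine ⟨r₁, c₁, hr₁, hc₁, ?_, ?_, ?_⟩
    · intro i j hi hj
      by_cases h : i ≤ m + 1 ∨ j ≤ m + 1
      · exact hpattern i j hi hj h
      · obtain ⟨rfl, rfl⟩ : i = m + 2 ∧ j = m + 2 := by omega
        rw [hr₁', hc₁']
        simp [hopen]
    · intro i hi e he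
      simp only [r₁, c₁, if_pos (show i ≤ m + 1 by omega), if_pos (show i + 1 ≤ m + 1 by omega)]
        at he ⊢
      split_ifs at he with h
      · exact hrr i h e he
      · obtain rfl : i = m := by omega
        exact hc4 e he
    · intro i hi e he
      simp only [r₁, c₁, if_pos (show i ≤ m + 1 by omega), if_pos (show i + 1 ≤ m + 1 by omega)]
        at he ⊢
      split_ifs at he with h
      · exact hcc i h e he
      · obtain rfl : i = m := by omega
        exact hr4 e he

theorem isStronglyChordal_of_isTotallyBalanced {V : Type*} {n : ℕ} {G : SimpleGraph V}
    {α₀ : Fin n ≃ V} (hG : IsTotallyBalanced (nbhdMatrix G α₀)) : IsStronglyChordal G := by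
  obtain ⟨α, hα⟩ := exists_doublyLexical_ordering G α₀
  refine ⟨n, α, isStrongElimOrdering_iff_not_hasDelta.2 ?_⟩
  rintro ⟨a, b, c, d, hab, hcd, hac, had, hbc, hbd⟩
  rw [nbhdMatrix_eq_one] at hac had hbc
  rw [nbhdMatrix_eq_zero] at hbd
  let R : Fin n → Fin n → Prop := fun p q => α p ∈ closedNbhd G (α q)
  have hsymm : ∀ i j, R i j ↔ R j i := fun i j => mem_closedNbhd_comm
  have hlex : ∀ p q d, p < q → R p d → ¬ R q d →
      ∃ d', d < d' ∧ ¬ R p d' ∧ R q d' ∧ ∀ e, d' < e → (R p e ↔ R q e) := by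
    intro p q d hpq h1 h2
    have := exists_last_difference (hα p q hpq) (d := d)
      (mem_nbhdPositions.2 (mem_closedNbhd_comm.1 h1))
      (fun h => h2 (mem_closedNbhd_comm.1 (mem_nbhdPositions.1 h)))
    simpa only [mem_nbhdPositions, R, mem_closedNbhd_comm] using this
  have hcycle : ∀ K, 2 ≤ K → ¬ ∃ r c : Fin (K + 1) ↪ Fin n,
      ∀ a b, R (r a) (c b) ↔ b = a ∨ b = finRotate (K + 1) a := by
    rintro K hK ⟨r, c, h⟩
    let σ : Fin n ↪ Fin n := (α.trans α₀.symm).toEmbedding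
    refine hG (K + 1) (r.trans σ) (c.trans σ) (by omega) fun a b => ?_
    have h' := h a b
    simp only [R] at h'
    simp only [nbhdMatrix, Matrix.of_apply, Function.Embedding.trans_apply, σ,
      Equiv.coe_toEmbedding, Equiv.trans_apply, Equiv.apply_symm_apply, h']
  obtain ⟨r, _, hr, -⟩ := exists_zigzag hsymm hlex hcycle hab hcd hac had hbc hbd n
  have hinj : Function.Injective fun i : Fin (n + 1) => r i := by
    intro i j hij
    rcases lt_trichotomy i j with h | h | h
    · exact absurd hij (hr i j h (by omega)).ne
    · exact h
    · exact absurd hij (hr j i h (by omega)).ne'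
  have := Fintype.card_le_of_injective _ hinj
  simp at this

/-! ### Reasoning about programs -/

@[simp] theorem State.setReg_reg (s : State) (x w y : ℕ) :
    (s.setReg x w).reg y = if y = x then w else s.reg y := by
  simp [State.setReg, Function.update_apply]

@[simp] theorem State.setReg_arr (s : State) (x w : ℕ) : (s.setReg x w).arr = s.arr := rfl

@[simp] theorem State.setArr_reg (s : State) (A i j w : ℕ) : (s.setArr A i j w).reg = s.reg := rfl

@[simp] theorem State.setArr_arr (s : State) (A i j w B a b : ℕ) :
    (s.setArr A i j w).arr B a b = if B = A ∧ a = i ∧ b = j then w else s.arr B a b := rfl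

/-- The register `y` is assigned to somewhere in the program. -/
def Prog.writesReg (y : ℕ) : Prog → Bool
  | .skip => false
  | .assign x _ => x == y
  | .store _ _ _ _ => false
  | .seq p q => p.writesReg y || q.writesReg y
  | .branch _ p q => p.writesReg y || q.writesReg y
  | .loop _ p => p.writesReg y

/-- The array `B` is stored to somewhere in the program. -/
def Prog.writesArr (B : ℕ) : Prog → Bool
  | .skip => false
  | .assign _ _ => false
  | .store A _ _ _ => A == B
  | .seq p q => p.writesArr B || q.writesArr B
  | .branch _ p q => p.writesArr B || q.writesArr B
  | .loop _ p => p.writesArr B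

/-- `s` and `s'` agree on all registers and arrays which `p` does not mention as a target. -/
def Preserves (p : Prog) (s s' : State) : Prop :=
  (∀ y, p.writesReg y = false → s'.reg y = s.reg y) ∧
    ∀ A, p.writesArr A = false → s'.arr A = s.arr A

theorem Preserves.refl (p : Prog) (s : State) : Preserves p s s := ⟨fun _ _ => rfl, fun _ _ => rfl⟩

theorem Preserves.trans {p : Prog} {s s' s'' : State} (h : Preserves p s s')
    (h' : Preserves p s' s'') : Preserves p s s'' :=
  ⟨fun y hy => (h'.1 y hy).trans (h.1 y hy), fun A hA => (h'.2 A hA).trans (h.2 A hA)⟩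

theorem Preserves.mono {p q : Prog} {s s' : State} (h : Preserves p s s')
    (hr : ∀ y, q.writesReg y = false → p.writesReg y = false)
    (ha : ∀ A, q.writesArr A = false → p.writesArr A = false) : Preserves q s s' :=
  ⟨fun y hy => h.1 y (hr y hy), fun A hA => h.2 A (ha A hA)⟩

theorem Exec.preserves {p : Prog} {s s' : State} {t : ℕ} (h : Exec p s t s') :
    Preserves p s s' := by
  induction h with
  | skip s => exact Preserves.refl _ _
  | assign s x e =>
    refine ⟨fun y hy => ?_, fun _ _ => rfl⟩
    have : y ≠ x := by rintro rfl; simp [Prog.writesReg] at hy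
    simp [this]
  | store s A e f g =>
    refine ⟨fun _ _ => rfl, fun B hB => ?_⟩
    have : B ≠ A := by rintro rfl; simp [Prog.writesArr] at hB
    ext a b
    simp [this]
  | seq _ _ ih₁ ih₂ =>
    exact (ih₁.mono (by simp +contextual [Prog.writesReg]) (by simp +contextual [Prog.writesArr])).trans
      (ih₂.mono (by simp +contextual [Prog.writesReg]) (by simp +contextual [Prog.writesArr]))
  | branch_true _ _ ih =>
    exact ih.mono (by simp +contextual [Prog.writesReg]) (by simp +contextual [Prog.writesArr])
  | branch_false _ _ ih =>
    exact ih.mono (by simp +contextual [Prog.writesReg]) (by simp +contextual [Prog.writesArr])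
  | loop_true _ _ _ ih₁ ih₂ =>
    exact (ih₁.mono (by simp [Prog.writesReg]) (by simp [Prog.writesArr])).trans ih₂
  | loop_false _ => exact Preserves.refl _ _

/-- Started in the state `s`, the program `p` halts within `T` steps in a state which satisfies
`Q`. -/
def Runs (p : Prog) (T : ℕ) (s : State) (Q : State → Prop) : Prop :=
  ∃ t s', Exec p s t s' ∧ t ≤ T ∧ Q s'

theorem Runs.mono {p : Prog} {T T' : ℕ} {s : State} {Q Q' : State → Prop} (h : Runs p T s Q)
    (hT : T ≤ T') (hQ : ∀ s', Preserves p s s' → Q s' → Q' s') : Runs p T' s Q' := by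
  obtain ⟨t, s', h1, h2, h3⟩ := h
  exact ⟨t, s', h1, h2.trans hT, hQ s' h1.preserves h3⟩

theorem Runs.skip {T : ℕ} {s : State} {Q : State → Prop} (hT : 1 ≤ T) (h : Q s) :
    Runs .skip T s Q :=
  ⟨_, _, .skip s, hT, h⟩

theorem Runs.assign {T : ℕ} {s : State} {Q : State → Prop} {x : ℕ} {e : Expr} {w : ℕ}
    (hT : e.cost + 1 ≤ T) (hw : e.eval s = w) (h : Q (s.setReg x w)) :
    Runs (.assign x e) T s Q :=
  ⟨_, _, .assign s x e, hT, hw ▸ h⟩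

theorem Runs.store {T : ℕ} {s : State} {Q : State → Prop} {A : ℕ} {e f g : Expr} {i j w : ℕ}
    (hT : e.cost + f.cost + g.cost + 1 ≤ T) (hi : e.eval s = i) (hj : f.eval s = j)
    (hw : g.eval s = w) (h : Q (s.setArr A i j w)) : Runs (.store A e f g) T s Q := by
  subst hi hj hw
  exact ⟨_, _, .store s A e f g, hT, h⟩

theorem Runs.seq {p q : Prog} {T : ℕ} (T₁ T₂ : ℕ) {s : State} {Q : State → Prop}
    (hT : T₁ + T₂ ≤ T) (h : Runs p T₁ s fun s' => Runs q T₂ s' Q) : Runs (.seq p q) T s Q := by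
  obtain ⟨t, s', h1, h2, t', s'', h3, h4, h5⟩ := h
  exact ⟨_, _, .seq h1 h3, (add_le_add h2 h4).trans hT, h5⟩

theorem Runs.branch {b : Test} {p q : Prog} {T : ℕ} (T₁ : ℕ) {s : State} {Q : State → Prop}
    (hT : b.cost + T₁ ≤ T) (hp : b.holds s → Runs p T₁ s Q) (hq : ¬ b.holds s → Runs q T₁ s Q) :
    Runs (.branch b p q) T s Q := by
  by_cases hb : b.holds s
  · obtain ⟨t, s', h1, h2, h3⟩ := hp hb
    exact ⟨_, _, .branch_true hb h1, (Nat.add_le_add_left h2 _).trans hT, h3⟩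
  · obtain ⟨t, s', h1, h2, h3⟩ := hq hb
    exact ⟨_, _, .branch_false hb h1, (Nat.add_le_add_left h2 _).trans hT, h3⟩

/-- The rule for `forUp` with an invariant `I` that is indexed by the value of the loop variable:
the loop ends when the range is exhausted or when `regCan` is reset. -/
theorem Runs.forUp {x : ℕ} {e : Expr} {p : Prog} {T n a : ℕ} {s : State} {I : ℕ → State → Prop}
    (hxp : p.writesReg x = false) (hnp : p.writesReg regN = false) (hxN : x ≠ regN)
    (hn : s.reg regN = n) (ha : e.eval s = a) (han : a ≤ n + 1) (h0 : I a (s.setReg x a))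
    (hstep : ∀ k s', a ≤ k → k ≤ n → s'.reg x = k → s'.reg regN = n → s'.reg regCan = 1 →
      Preserves (forUp x e p) s s' → I k s' →
      Runs p T s' fun s'' => I (k + 1) (s''.setReg x (k + 1))) :
    Runs (forUp x e p) (e.cost + 8 + (n + 1 - a) * (T + 10)) s fun s' =>
      ∃ k, a ≤ k ∧ k ≤ n + 1 ∧ s'.reg x = k ∧ I k s' ∧ (k = n + 1 ∨ s'.reg regCan ≠ 1) := by
  set b : Test := .conj (.le (.var x) (.var regN)) (.eq (.var regCan) (.lit 1)) with hb
  have hcost : b.cost = 7 := rfl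
  have key : ∀ d k s', k + d = n + 1 → a ≤ k → s'.reg x = k → s'.reg regN = n →
      Preserves (SCG.forUp x e p) s s' → I k s' →
      Runs (.loop b (.seq p (.assign x (.succ (.var x))))) (7 + d * (T + 10)) s' fun s' =>
        ∃ k, a ≤ k ∧ k ≤ n + 1 ∧ s'.reg x = k ∧ I k s' ∧ (k = n + 1 ∨ s'.reg regCan ≠ 1) := by
    intro d
    induction d with
    | zero =>
      intro k s' hk hak hx hN hpre hI
      refine ⟨_, s', .loop_false ?_, by omega, k, hak, by omega, hx, hI, Or.inl (by omega)⟩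
      simp only [hb, Test.holds, Expr.eval, hx, hN]
      omega
    | succ d ih =>
      intro k s' hk hak hx hN hpre hI
      by_cases hc : s'.reg regCan = 1
      · obtain ⟨t, s₁, h1, h2, h3⟩ := hstep k s' hak (by omega) hx hN hc hpre hI
        have hx₁ : s₁.reg x = k := (h1.preserves.1 x hxp).trans hx
        have hN₁ : s₁.reg regN = n := (h1.preserves.1 regN hnp).trans hN
        have h4 := Exec.assign s₁ x (.succ (.var x))
        have he : (Expr.succ (.var x)).eval s₁ = k + 1 := by simp [Expr.eval, hx₁]
        rw [he] at h4
        have hpre₁ : Preserves (SCG.forUp x e p) s (s₁.setReg x (k + 1)) := by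
          refine hpre.trans ((Exec.seq h1 h4).preserves.mono ?_ ?_) <;>
            simp +contextual [SCG.forUp, Prog.writesReg, Prog.writesArr]
        obtain ⟨t', s₂, h5, h6, h7⟩ := ih (k + 1) (s₁.setReg x (k + 1)) (by omega) (by omega)
          (by simp) (by simp [hxN.symm, hN₁]) hpre₁ h3
        refine ⟨_, s₂, .loop_true ?_ (.seq h1 h4) h5, ?_, h7⟩
        · simp only [hb, Test.holds, Expr.eval, hx, hN]
          exact ⟨by omega, hc⟩
        · show 7 + (t + 3) + t' ≤ _
          rw [Nat.succ_mul]
          omega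
      · refine ⟨_, s', .loop_false ?_, by omega, k, hak, by omega, hx, hI, Or.inr hc⟩
        exact fun h => hc h.2
  have h1 := Exec.assign s x e
  rw [ha] at h1
  obtain ⟨t, s', h2, h3, h4⟩ := key (n + 1 - a) a (s.setReg x a) (by omega) le_rfl (by simp)
    (by simp [hxN.symm, hn])
    (h1.preserves.mono (by simp +contextual [SCG.forUp, Prog.writesReg])
      (by simp +contextual [SCG.forUp, Prog.writesArr])) h0
  exact ⟨_, s', .seq h1 h2, by omega, h4⟩

/-- The rule for `forDown`, with the invariant indexed by the value of the loop variable. -/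
theorem Runs.forDown {x : ℕ} {e : Expr} {p : Prog} {T a : ℕ} {s : State} {I : ℕ → State → Prop}
    (hxp : p.writesReg x = false) (ha : e.eval s = a) (h0 : I a (s.setReg x a))
    (hstep : ∀ k s', 1 ≤ k → k ≤ a → s'.reg x = k → s'.reg regCan = 1 →
      Preserves (forDown x e p) s s' → I k s' →
      Runs p T s' fun s'' => I (k - 1) (s''.setReg x (k - 1))) :
    Runs (forDown x e p) (e.cost + 8 + a * (T + 10)) s fun s' =>
      ∃ k, k ≤ a ∧ s'.reg x = k ∧ I k s' ∧ (k = 0 ∨ s'.reg regCan ≠ 1) := by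
  set b : Test := .conj (.le (.lit 1) (.var x)) (.eq (.var regCan) (.lit 1)) with hb
  have hcost : b.cost = 7 := rfl
  have key : ∀ k s', k ≤ a → s'.reg x = k → Preserves (SCG.forDown x e p) s s' → I k s' →
      Runs (.loop b (.seq p (.assign x (.pred (.var x))))) (7 + k * (T + 10)) s' fun s' =>
        ∃ k, k ≤ a ∧ s'.reg x = k ∧ I k s' ∧ (k = 0 ∨ s'.reg regCan ≠ 1) := by
    intro k
    induction k with
    | zero =>
      intro s' hk hx hpre hI
      refine ⟨_, s', .loop_false ?_, by omega, 0, hk, hx, hI, Or.inl rfl⟩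
      simp [hb, Test.holds, Expr.eval, hx]
    | succ k ih =>
      intro s' hk hx hpre hI
      by_cases hc : s'.reg regCan = 1
      · obtain ⟨t, s₁, h1, h2, h3⟩ := hstep (k + 1) s' (by omega) hk hx hc hpre hI
        have hx₁ : s₁.reg x = k + 1 := (h1.preserves.1 x hxp).trans hx
        have h4 := Exec.assign s₁ x (.pred (.var x))
        have he : (Expr.pred (.var x)).eval s₁ = k := by simp [Expr.eval, hx₁]
        rw [he] at h4
        have hpre₁ : Preserves (SCG.forDown x e p) s (s₁.setReg x k) := by
          refine hpre.trans ((Exec.seq h1 h4).preserves.mono ?_ ?_) <;>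
            simp +contextual [SCG.forDown, Prog.writesReg, Prog.writesArr]
        obtain ⟨t', s₂, h5, h6, h7⟩ := ih (s₁.setReg x k) (by omega) (by simp) hpre₁ h3
        refine ⟨_, s₂, .loop_true ?_ (.seq h1 h4) h5, ?_, h7⟩
        · simp [hb, Test.holds, Expr.eval, hx, hc]
        · show 7 + (t + 3) + t' ≤ _
          rw [Nat.succ_mul]
          omega
      · refine ⟨_, s', .loop_false ?_, by omega, k + 1, hk, hx, hI, Or.inr hc⟩
        exact fun h => hc h.2
  have h1 := Exec.assign s x e
  rw [ha] at h1
  obtain ⟨t, s', h2, h3, h4⟩ := key a (s.setReg x a) le_rfl (by simp)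
    (h1.preserves.mono (by simp +contextual [SCG.forDown, Prog.writesReg])
      (by simp +contextual [SCG.forDown, Prog.writesArr])) h0
  exact ⟨_, s', .seq h1 h2, by omega, h4⟩

/-! ### The three searches of Insert-Query -/

/-- `regCan` holds the truth value of `¬ C`. -/
def Rejected (s : State) (C : Prop) : Prop :=
  (s.reg regCan = 1 ∧ ¬ C) ∨ (s.reg regCan = 0 ∧ C)

theorem Rejected.congr {s : State} {C C' : Prop} (h : Rejected s C) (hC : C ↔ C') :
    Rejected s C' := by
  simpa only [Rejected, hC] using h

theorem Rejected.of_reg_eq_one {s : State} (h : s.reg regCan = 1) : Rejected s False :=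
  Or.inl ⟨h, not_false⟩

theorem Rejected.not_of_reg_eq_one {s : State} {C : Prop} (h : Rejected s C)
    (h1 : s.reg regCan = 1) : ¬ C := by
  rcases h with h | h
  · exact h.2
  · omega

theorem Rejected.of_reg_ne_one {s : State} {C : Prop} (h : Rejected s C)
    (h1 : s.reg regCan ≠ 1) : s.reg regCan = 0 ∧ C := by
  rcases h with h | h
  · exact absurd h.1 h1
  · exact h

theorem Rejected.setReg {s : State} {C : Prop} {x w : ℕ} (h : Rejected s C) (hx : x ≠ regCan) :
    Rejected (s.setReg x w) C := by
  simpa [Rejected, hx.symm] using h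

theorem Runs.rejectIf {b : Test} {s : State} (hcan : s.reg regCan = 1) :
    Runs (SCG.rejectIf b) (b.cost + 2) s fun s' => Rejected s' (b.holds s) := by
  refine Runs.branch 2 le_rfl (fun hb => ?_) fun hb => ?_
  · exact Runs.assign (w := 0) le_rfl rfl (Or.inr ⟨by simp, hb⟩)
  · exact Runs.skip (by omega) (Or.inl ⟨hcan, hb⟩)

/-- If the body, run for the value `k` of the loop variable, rejects exactly when `C k` holds, then
the loop rejects exactly when `C k` holds for some `k` in its range. -/
theorem Runs.forUp_rejected {x : ℕ} {e : Expr} {p : Prog} {T n a : ℕ} {s : State} {C₀ : Prop}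
    {C : ℕ → Prop} (hxp : p.writesReg x = false) (hnp : p.writesReg regN = false)
    (hxN : x ≠ regN) (hxc : x ≠ regCan) (hn : s.reg regN = n) (ha : e.eval s = a)
    (han : a ≤ n + 1) (h0 : Rejected s C₀)
    (hstep : ∀ k s', a ≤ k → k ≤ n → s'.reg x = k → s'.reg regCan = 1 →
      Preserves (SCG.forUp x e p) s s' → Runs p T s' fun s'' => Rejected s'' (C k)) :
    Runs (SCG.forUp x e p) (e.cost + 8 + (n + 1) * (T + 10)) s fun s' =>
      Rejected s' (C₀ ∨ ∃ k, a ≤ k ∧ k ≤ n ∧ C k) := by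
  refine (Runs.forUp (I := fun k s' => Rejected s' (C₀ ∨ ∃ k', a ≤ k' ∧ k' < k ∧ C k')) hxp hnp hxN
    hn ha han ?_ (T := T) ?_).mono ?_ ?_
  · refine (h0.setReg hxc).congr (iff_of_eq (or_iff_left ?_).eq.symm)
    rintro ⟨k, h1, h2, -⟩; omega
  · intro k s' h1 h2 h3 h4 h5 h6 h7
    refine (hstep k s' h1 h2 h3 h5 h6).mono le_rfl fun s'' _ h => ?_
    have hno := h7.not_of_reg_eq_one h5
    refine (h.setReg hxc).congr ⟨fun h => Or.inr ⟨k, h1, by omega, h⟩, ?_⟩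
    rintro (h | ⟨k', h8, h9, h10⟩)
    · exact absurd (Or.inl h) hno
    · rcases Nat.lt_succ_iff_lt_or_eq.1 h9 with h | rfl
      · exact absurd (Or.inr ⟨k', h8, h, h10⟩) hno
      · exact h10
  · gcongr; omega
  · rintro s' - ⟨k, h1, h2, -, h3, h4⟩
    rcases h4 with rfl | h4
    · exact h3.congr (by simp only [Nat.lt_succ_iff])
    · obtain ⟨h5, h6⟩ := h3.of_reg_ne_one h4
      refine Or.inr ⟨h5, h6.imp_right ?_⟩
      rintro ⟨k', h7, h8, h9⟩
      exact ⟨k', h7, by omega, h9⟩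

theorem Runs.forDown_rejected {x : ℕ} {e : Expr} {p : Prog} {T a : ℕ} {s : State} {C₀ : Prop}
    {C : ℕ → Prop} (hxp : p.writesReg x = false) (hxc : x ≠ regCan) (ha : e.eval s = a)
    (h0 : Rejected s C₀)
    (hstep : ∀ k s', 1 ≤ k → k ≤ a → s'.reg x = k → s'.reg regCan = 1 →
      Preserves (SCG.forDown x e p) s s' → Runs p T s' fun s'' => Rejected s'' (C k)) :
    Runs (SCG.forDown x e p) (e.cost + 8 + a * (T + 10)) s fun s' =>
      Rejected s' (C₀ ∨ ∃ k, 1 ≤ k ∧ k ≤ a ∧ C k) := by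
  refine (Runs.forDown (I := fun k s' => Rejected s' (C₀ ∨ ∃ k', k < k' ∧ k' ≤ a ∧ C k')) hxp ha
    ?_ (T := T) ?_).mono le_rfl ?_
  · refine (h0.setReg hxc).congr (iff_of_eq (or_iff_left ?_).eq.symm)
    rintro ⟨k, h1, h2, -⟩; omega
  · intro k s' h1 h2 h3 h5 h6 h7
    refine (hstep k s' h1 h2 h3 h5 h6).mono le_rfl fun s'' _ h => ?_
    have hno := h7.not_of_reg_eq_one h5
    refine (h.setReg hxc).congr ⟨fun h => Or.inr ⟨k, by omega, h2, h⟩, ?_⟩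
    rintro (h | ⟨k', h8, h9, h10⟩)
    · exact absurd (Or.inl h) hno
    · rcases (show k ≤ k' by omega).lt_or_eq with h | rfl
      · exact absurd (Or.inr ⟨k', h, h9, h10⟩) hno
      · exact h10
  · rintro s' - ⟨k, h2, -, h3, h4⟩
    rcases h4 with rfl | h4
    · exact h3
    · obtain ⟨h5, h6⟩ := h3.of_reg_ne_one h4
      refine Or.inr ⟨h5, h6.imp_right ?_⟩
      rintro ⟨k', h7, h8, h9⟩
      exact ⟨k', by omega, h8, h9⟩

theorem Runs.searchDown {s : State} {n i j : ℕ} {C₀ : Prop} (hn : s.reg regN = n)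
    (hi : s.reg regI = i) (hj : s.reg regJ = j) (hin : i ≤ n) (hjn : j ≤ n) (h0 : Rejected s C₀) :
    Runs searchDown (9 + (n + 1) * (9 + (n + 1) * 36 + 10)) s fun s' =>
      Rejected s' (C₀ ∨ ∃ l, j ≤ l ∧ l ≤ n ∧ ∃ k, i ≤ k ∧ k ≤ n ∧ s.arr arrM i (l + 1) = 1 ∧
        s.arr arrM (k + 1) j = 1 ∧ s.arr arrM (k + 1) (l + 1) = 0) := by
  refine Runs.forUp_rejected rfl rfl (by decide) (by decide) hn hj (by omega) h0 ?_
  intro l s₁ _ _ hl hc₁ hp₁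
  refine (Runs.forUp_rejected (e := .var regI) (T := 26) (n := n) rfl rfl (by decide) (by decide)
    ((hp₁.1 _ rfl).trans hn) ((hp₁.1 regI rfl).trans hi) (by omega)
    (Rejected.of_reg_eq_one hc₁) ?_).mono le_rfl fun s' _ h => h.congr (iff_of_eq (false_or _))
  intro k s₂ _ _ hk hc₂ hp₂
  refine (Runs.rejectIf hc₂).mono (by decide) fun s' _ h => h.congr ?_
  have hl₂ := (hp₂.1 regL rfl).trans hl
  have hi₂ := (hp₂.1 regI rfl).trans ((hp₁.1 regI rfl).trans hi)
  have hj₂ := (hp₂.1 regJ rfl).trans ((hp₁.1 regJ rfl).trans hj)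
  have hM₂ := (hp₂.2 arrM rfl).trans (hp₁.2 arrM rfl)
  simp only [Test.holds, entryIs, Expr.eval, hl₂, hi₂, hj₂, hM₂, hk]

theorem Runs.searchUp {s : State} {n i j : ℕ} {C₀ : Prop} (hn : s.reg regN = n)
    (hi : s.reg regI = i) (hj : s.reg regJ = j) (hin : i ≤ n) (hjn : j ≤ n) (h0 : Rejected s C₀) :
    Runs searchUp (9 + (n + 1) * (9 + (n + 1) * 36 + 10)) s fun s' =>
      Rejected s' (C₀ ∨ ∃ l, j ≤ l ∧ l ≤ n ∧ ∃ k, 1 ≤ k ∧ k ≤ i ∧ s.arr arrM (k - 1) j = 1 ∧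
        s.arr arrM (k - 1) (l + 1) = 1 ∧ s.arr arrM i (l + 1) = 0) := by
  refine Runs.forUp_rejected rfl rfl (by decide) (by decide) hn hj (by omega) h0 ?_
  intro l s₁ _ _ hl hc₁ hp₁
  refine (Runs.forDown_rejected (e := .var regI) (T := 26) rfl (by decide) ((hp₁.1 regI rfl).trans hi)
    (Rejected.of_reg_eq_one hc₁) ?_).mono ?_ fun s' _ h => h.congr (iff_of_eq (false_or _))
  · intro k s₂ _ _ hk hc₂ hp₂
    refine (Runs.rejectIf hc₂).mono (by decide) fun s' _ h => h.congr ?_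
    have hl₂ := (hp₂.1 regL rfl).trans hl
    have hi₂ := (hp₂.1 regI rfl).trans ((hp₁.1 regI rfl).trans hi)
    have hj₂ := (hp₂.1 regJ rfl).trans ((hp₁.1 regJ rfl).trans hj)
    have hM₂ := (hp₂.2 arrM rfl).trans (hp₁.2 arrM rfl)
    simp only [Test.holds, entryIs, Expr.eval, hl₂, hi₂, hj₂, hM₂, hk]
  · simp only [Expr.cost]; omega

theorem Runs.searchLeft {s : State} {n i j : ℕ} {C₀ : Prop} (hn : s.reg regN = n)
    (hi : s.reg regI = i) (hj : s.reg regJ = j) (hin : i ≤ n) (hjn : j ≤ n) (h0 : Rejected s C₀) :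
    Runs searchLeft (9 + (n + 1) * (9 + (n + 1) * 36 + 10)) s fun s' =>
      Rejected s' (C₀ ∨ ∃ l, 1 ≤ l ∧ l ≤ j ∧ ∃ k, i ≤ k ∧ k ≤ n ∧ s.arr arrM i (l - 1) = 1 ∧
        s.arr arrM (k + 1) (l - 1) = 1 ∧ s.arr arrM (k + 1) j = 0) := by
  refine (Runs.forDown_rejected (e := .var regJ) (T := 9 + (n + 1) * 36) rfl (by decide) hj h0 ?_).mono ?_
    fun s' _ h => h
  · intro l s₁ _ _ hl hc₁ hp₁
    refine (Runs.forUp_rejected (e := .var regI) (T := 26) (n := n) rfl rfl (by decide) (by decide)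
      ((hp₁.1 _ rfl).trans hn) ((hp₁.1 regI rfl).trans hi) (by omega)
      (Rejected.of_reg_eq_one hc₁) ?_).mono le_rfl fun s' _ h => h.congr (iff_of_eq (false_or _))
    intro k s₂ _ _ hk hc₂ hp₂
    refine (Runs.rejectIf hc₂).mono (by decide) fun s' _ h => h.congr ?_
    have hl₂ := (hp₂.1 regL rfl).trans hl
    have hi₂ := (hp₂.1 regI rfl).trans ((hp₁.1 regI rfl).trans hi)
    have hj₂ := (hp₂.1 regJ rfl).trans ((hp₁.1 regJ rfl).trans hj)
    have hM₂ := (hp₂.2 arrM rfl).trans (hp₁.2 arrM rfl)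
    simp only [Test.holds, entryIs, Expr.eval, hl₂, hi₂, hj₂, hM₂, hk]
  · simp only [Expr.cost]
    gcongr
    omega

/-! ### Where a new `Δ` can appear -/

/-- When the entries `(i, j)` and `(j, i)` of a symmetric matrix without `Δ` and with ones on the
diagonal are set to `1`, each new `Δ` has, up to transposition, the entry `(i, j)` as one of its
three ones. -/
theorem hasDelta_setEntry_iff {n : ℕ} {M : Matrix (Fin n) (Fin n) ℕ} (hM : ∀ a b, M a b = M b a)
    (hdiag : ∀ a, M a a = 1) (hdelta : ¬ HasDelta M) {i j : Fin n} (hij : i ≠ j) :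
    HasDelta (setEntry M i j) ↔
      (∃ d b, j < d ∧ i < b ∧ M i d = 1 ∧ M b j = 1 ∧ M b d = 0) ∨
      (∃ d a, j < d ∧ a < i ∧ M a j = 1 ∧ M a d = 1 ∧ M i d = 0) ∨
      (∃ c b, c < j ∧ i < b ∧ M i c = 1 ∧ M b c = 1 ∧ M b j = 0) := by
  have hone : ∀ a b, setEntry M i j a b = 1 ↔
      ((a = i ∧ b = j) ∨ (a = j ∧ b = i)) ∨ M a b = 1 := by
    intro a b
    simp only [setEntry, Matrix.of_apply]
    split_ifs with h <;> simp [h]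
  have hzero : ∀ a b, setEntry M i j a b = 0 ↔
      ¬ ((a = i ∧ b = j) ∨ (a = j ∧ b = i)) ∧ M a b = 0 := by
    intro a b
    simp only [setEntry, Matrix.of_apply]
    split_ifs with h <;> simp [h]
  have hs : ∀ a b, setEntry M i j a b = setEntry M i j b a := by
    intro a b
    simp only [setEntry, Matrix.of_apply, hM a b, and_comm, or_comm]
  constructor
  · -- It is enough to treat the cases in which `(i, j)` itself is among the three ones.
    have upper_left : ∀ b d, i < b → j < d → setEntry M i j i d = 1 → setEntry M i j b j = 1 →
        setEntry M i j b d = 0 → ∃ d b, j < d ∧ i < b ∧ M i d = 1 ∧ M b j = 1 ∧ M b d = 0 := by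
      intro b d hb hd h1 h2 h3
      rw [hone] at h1 h2
      rw [hzero] at h3
      refine ⟨d, b, hd, hb, h1.resolve_left ?_, h2.resolve_left ?_, h3.2⟩
      · rintro (⟨-, rfl⟩ | ⟨h, -⟩)
        exacts [lt_irrefl _ hd, hij h]
      · rintro (⟨rfl, -⟩ | ⟨-, h⟩)
        exacts [lt_irrefl _ hb, hij h.symm]
    have lower_left : ∀ a d, a < i → j < d → setEntry M i j a j = 1 → setEntry M i j a d = 1 →
        setEntry M i j i d = 0 → ∃ d a, j < d ∧ a < i ∧ M a j = 1 ∧ M a d = 1 ∧ M i d = 0 := by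
      intro a d ha hd h1 h2 h3
      rw [hone] at h1 h2
      rw [hzero] at h3
      refine ⟨d, a, hd, ha, h1.resolve_left ?_, h2.resolve_left ?_, h3.2⟩
      · rintro (⟨rfl, -⟩ | ⟨-, h⟩)
        exacts [lt_irrefl _ ha, hij h.symm]
      · rintro (⟨rfl, -⟩ | ⟨-, rfl⟩)
        · exact lt_irrefl _ ha
        · simp [hdiag] at h3
    have upper_right : ∀ b c, i < b → c < j → setEntry M i j i c = 1 → setEntry M i j b c = 1 →
        setEntry M i j b j = 0 → ∃ c b, c < j ∧ i < b ∧ M i c = 1 ∧ M b c = 1 ∧ M b j = 0 := by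
      intro b c hb hc h1 h2 h3
      rw [hone] at h1 h2
      rw [hzero] at h3
      refine ⟨c, b, hc, hb, h1.resolve_left ?_, h2.resolve_left ?_, h3.2⟩
      · rintro (⟨-, rfl⟩ | ⟨h, -⟩)
        exacts [lt_irrefl _ hc, hij h]
      · rintro (⟨rfl, -⟩ | ⟨rfl, -⟩)
        · exact lt_irrefl _ hb
        · simp [hdiag] at h3
    rintro ⟨a, b, c, d, hab, hcd, hac, had, hbc, hbd⟩
    have hac' := hac
    have had' := had
    have hbc' := hbc
    rw [hone] at hac' had' hbc'
    rcases hac' with (⟨rfl, rfl⟩ | ⟨rfl, rfl⟩) | hac'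
    · exact Or.inl (upper_left b d hab hcd had hbc hbd)
    · exact Or.inl (upper_left d b hcd hab (by rwa [hs]) (by rwa [hs]) (by rwa [hs]))
    rcases had' with (⟨rfl, rfl⟩ | ⟨rfl, rfl⟩) | had'
    · exact Or.inr (Or.inr (upper_right b c hab hcd hac hbc hbd))
    · exact Or.inr (Or.inl (lower_left c b hcd hab (by rwa [hs]) (by rwa [hs]) (by rwa [hs])))
    rcases hbc' with (⟨rfl, rfl⟩ | ⟨rfl, rfl⟩) | hbc'
    · exact Or.inr (Or.inl (lower_left a d hab hcd hac had hbd))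
    · exact Or.inr (Or.inr (upper_right d a hcd hab (by rwa [hs]) (by rwa [hs]) (by rwa [hs])))
    exact absurd ⟨a, b, c, d, hab, hcd, hac', had', hbc', ((hzero _ _).1 hbd).2⟩ hdelta
  · rintro (⟨d, b, hd, hb, h1, h2, h3⟩ | ⟨d, a, hd, ha, h1, h2, h3⟩ | ⟨c, b, hc, hb, h1, h2, h3⟩)
    · refine ⟨i, b, j, d, hb, hd, ?_, ?_, ?_, ?_⟩ <;> simp only [hone, hzero] <;> grind
    · refine ⟨a, i, j, d, ha, hd, ?_, ?_, ?_, ?_⟩ <;> simp only [hone, hzero] <;> grind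
    · refine ⟨i, b, c, j, hb, hc, ?_, ?_, ?_, ?_⟩ <;> simp only [hone, hzero] <;> grind

/-- The three searches, carried out on the array that holds `M` surrounded by zeros, look through
exactly the places where a new `Δ` can appear. -/
theorem searches_iff {n : ℕ} {M : Matrix (Fin n) (Fin n) ℕ} {A : ℕ → ℕ → ℕ}
    (hA : ∀ a b : Fin n, A (a + 1) (b + 1) = M a b)
    (hA0 : ∀ a b, a = 0 ∨ n < a ∨ b = 0 ∨ n < b → A a b = 0) (i j : Fin n) :
    ((∃ l, j.val + 1 ≤ l ∧ l ≤ n ∧ ∃ k, i.val + 1 ≤ k ∧ k ≤ n ∧ A (i + 1) (l + 1) = 1 ∧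
        A (k + 1) (j + 1) = 1 ∧ A (k + 1) (l + 1) = 0) ↔
      ∃ d b, j < d ∧ i < b ∧ M i d = 1 ∧ M b j = 1 ∧ M b d = 0) ∧
    ((∃ l, j.val + 1 ≤ l ∧ l ≤ n ∧ ∃ k, 1 ≤ k ∧ k ≤ i.val + 1 ∧ A (k - 1) (j + 1) = 1 ∧
        A (k - 1) (l + 1) = 1 ∧ A (i + 1) (l + 1) = 0) ↔
      ∃ d a, j < d ∧ a < i ∧ M a j = 1 ∧ M a d = 1 ∧ M i d = 0) ∧
    ((∃ l, 1 ≤ l ∧ l ≤ j.val + 1 ∧ ∃ k, i.val + 1 ≤ k ∧ k ≤ n ∧ A (i + 1) (l - 1) = 1 ∧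
        A (k + 1) (l - 1) = 1 ∧ A (k + 1) (j + 1) = 0) ↔
      ∃ c b, c < j ∧ i < b ∧ M i c = 1 ∧ M b c = 1 ∧ M b j = 0) := by
  have hrange : ∀ a b, A a b = 1 → (1 ≤ a ∧ a ≤ n) ∧ (1 ≤ b ∧ b ≤ n) := by
    intro a b h
    by_contra hc
    have := hA0 a b (by omega)
    omega
  have hA' : ∀ (a b : ℕ) (ha : a < n) (hb : b < n), A (a + 1) (b + 1) = M ⟨a, ha⟩ ⟨b, hb⟩ :=
    fun a b ha hb => hA ⟨a, ha⟩ ⟨b, hb⟩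
  have hi := i.isLt
  have hj := j.isLt
  refine ⟨⟨?_, ?_⟩, ⟨?_, ?_⟩, ⟨?_, ?_⟩⟩
  · rintro ⟨l, hl, -, k, hk, -, h1, h2, h3⟩
    have r1 := hrange _ _ h1
    have r2 := hrange _ _ h2
    rw [hA' _ _ hi (by omega)] at h1
    rw [hA' _ _ (by omega) hj] at h2
    rw [hA' _ _ (by omega) (by omega)] at h3
    exact ⟨⟨l, _⟩, ⟨k, _⟩, Fin.lt_def.2 hl, Fin.lt_def.2 hk, h1, h2, h3⟩
  · rintro ⟨d, b, hd, hb, h1, h2, h3⟩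
    rw [← hA] at h1 h2 h3
    exact ⟨d, hd, d.isLt.le, b, hb, b.isLt.le, h1, h2, h3⟩
  · rintro ⟨l, hl, -, k, hk, hki, h1, h2, h3⟩
    have r1 := hrange _ _ h1
    have r2 := hrange _ _ h2
    obtain ⟨k, rfl⟩ := Nat.exists_eq_add_of_le' (show 2 ≤ k by omega)
    rw [show k + 2 - 1 = k + 1 by omega] at h1 h2
    rw [hA' _ _ (by omega) hj] at h1
    rw [hA' _ _ (by omega) (by omega)] at h2
    rw [hA' _ _ hi (by omega)] at h3
    exact ⟨⟨l, _⟩, ⟨k, _⟩, Fin.lt_def.2 hl, Fin.lt_def.2 (show k < i by omega), h1, h2, h3⟩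
  · rintro ⟨d, a, hd, ha, h1, h2, h3⟩
    rw [← hA] at h1 h2 h3
    refine ⟨d, hd, d.isLt.le, a + 2, by omega, ?_, ?_, ?_, h3⟩
    · rw [Fin.lt_def] at ha; omega
    · exact h1
    · exact h2
  · rintro ⟨l, hl, hlj, k, hk, hki, h1, h2, h3⟩
    have r1 := hrange _ _ h1
    have r2 := hrange _ _ h2
    obtain ⟨l, rfl⟩ := Nat.exists_eq_add_of_le' (show 2 ≤ l by omega)
    rw [show l + 2 - 1 = l + 1 by omega] at h1 h2
    rw [hA' _ _ hi (by omega)] at h1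
    rw [hA' _ _ (by omega) (by omega)] at h2
    rw [hA' _ _ (by omega) hj] at h3
    exact ⟨⟨l, _⟩, ⟨k, _⟩, Fin.lt_def.2 (show l < j by omega), Fin.lt_def.2 hk, h1, h2, h3⟩
  · rintro ⟨c, b, hc, hb, h1, h2, h3⟩
    rw [← hA] at h1 h2 h3
    refine ⟨c + 2, by omega, ?_, b, hb, b.isLt.le, ?_, ?_, h3⟩
    · rw [Fin.lt_def] at hc; omega
    · exact h1
    · exact h2

/-! ### Insert-Query and the update of the matrix -/

/-- Insert-Query leaves the positions of `u` and `v` in `regI` and `regJ`, and it rejects exactly the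
edges of `G` and the pairs whose insertion would create a `Δ`. -/
theorem Runs.insertQuery {n : ℕ} {G : SimpleGraph (Fin n)} {α : Fin n ≃ Fin n} {u v : Fin n}
    {s : State} (hα : IsStrongElimOrdering G α) (huv : u ≠ v) (hs : Represents G α s)
    (hu : s.reg regU = u.val + 1) (hv : s.reg regV = v.val + 1) :
    Runs insertQuery (1000 * n ^ 2) s fun s' =>
      s'.reg regI = (α.symm u).val + 1 ∧ s'.reg regJ = (α.symm v).val + 1 ∧
      Rejected s' (G.Adj u v ∨ HasDelta (setEntry (nbhdMatrix G α) (α.symm u) (α.symm v))) := by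
  obtain ⟨hn, -, hpos, hM, hM0⟩ := hs
  set i := α.symm u with hi
  set j := α.symm v with hj
  have hij : i ≠ j := fun h => huv (α.symm.injective h)
  have hn0 : 1 ≤ n := by have := u.isLt; omega
  have hentry : nbhdMatrix G α i j = 1 ↔ G.Adj u v := by
    rw [nbhdMatrix_eq_one, mem_closedNbhd, G.adj_comm]
    simp [hi, hj, huv]
  have hdelta := hasDelta_setEntry_iff (fun a b => nbhdMatrix_comm)
    (fun a => nbhdMatrix_eq_one.2 (mem_closedNbhd.2 (Or.inl rfl)))
    (isStrongElimOrdering_iff_not_hasDelta.1 hα) hij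
  have hsearch := searches_iff hM hM0 i j
  set T := 3 * (9 + (n + 1) * (9 + (n + 1) * 36 + 10)) with hT
  refine Runs.seq 2 (8 + 5 + T) (by nlinarith) (Runs.assign (w := 1) le_rfl rfl ?_)
  refine Runs.seq 4 (4 + 5 + T) (by omega) (Runs.assign (w := i.val + 1) le_rfl ?_ ?_)
  · simp [Expr.eval, hu, hpos, hi]
  refine Runs.seq 4 (5 + T) (by omega) (Runs.assign (w := j.val + 1) le_rfl ?_ ?_)
  · simp [Expr.eval, hv, hpos, hj]
  set s₁ := ((s.setReg regCan 1).setReg regI (i.val + 1)).setReg regJ (j.val + 1) with hs₁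
  have hn₁ : s₁.reg regN = n := by simp [hs₁, hn]
  have hi₁ : s₁.reg regI = i.val + 1 := by simp [hs₁]
  have hj₁ : s₁.reg regJ = j.val + 1 := by simp [hs₁]
  have hc₁ : s₁.reg regCan = 1 := by simp [hs₁]
  have ha₁ : s₁.arr = s.arr := rfl
  have hin : i.val + 1 ≤ n := i.isLt
  have hjn : j.val + 1 ≤ n := j.isLt
  have hholds : (entryIs (.var regI) (.var regJ) 1).holds s₁ ↔ G.Adj u v := by
    simp only [entryIs, Test.holds, Expr.eval, hi₁, hj₁, ha₁, hM, hentry]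
  refine Runs.branch T le_rfl (fun hb => ?_) fun hb => ?_
  · refine (Runs.assign (w := 0) (by simp only [Expr.cost]; omega) rfl ⟨?_, ?_, ?_⟩)
    · simp [hi₁]
    · simp [hj₁]
    · exact Or.inr ⟨by simp, Or.inl (hholds.1 hb)⟩
  · refine Runs.seq (9 + (n + 1) * (9 + (n + 1) * 36 + 10))
      (2 * (9 + (n + 1) * (9 + (n + 1) * 36 + 10))) (by omega)
      ((Runs.searchDown hn₁ hi₁ hj₁ hin hjn (Rejected.of_reg_eq_one hc₁)).mono le_rfl ?_)
    intro s₂ hp₂ hr₂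
    refine Runs.seq (9 + (n + 1) * (9 + (n + 1) * 36 + 10))
      (9 + (n + 1) * (9 + (n + 1) * 36 + 10)) (by omega)
      ((Runs.searchUp ((hp₂.1 regN rfl).trans hn₁) ((hp₂.1 regI rfl).trans hi₁)
        ((hp₂.1 regJ rfl).trans hj₁) hin hjn hr₂).mono le_rfl ?_)
    intro s₃ hp₃ hr₃
    refine ((Runs.searchLeft ((hp₃.1 regN rfl).trans ((hp₂.1 regN rfl).trans hn₁))
      ((hp₃.1 regI rfl).trans ((hp₂.1 regI rfl).trans hi₁))
      ((hp₃.1 regJ rfl).trans ((hp₂.1 regJ rfl).trans hj₁)) hin hjn hr₃).mono le_rfl ?_)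
    intro s₄ hp₄ hr₄
    refine ⟨?_, ?_, hr₄.congr ?_⟩
    · rw [hp₄.1 regI rfl, hp₃.1 regI rfl, hp₂.1 regI rfl, hi₁]
    · rw [hp₄.1 regJ rfl, hp₃.1 regJ rfl, hp₂.1 regJ rfl, hj₁]
    · rw [hp₃.2 arrM rfl, hp₂.2 arrM rfl, ha₁, hsearch.1, hsearch.2.1, hsearch.2.2, hdelta,
        false_or, or_assoc, or_iff_right (fun h => hb (hholds.2 h))]

theorem Represents.congr {n : ℕ} {G : SimpleGraph (Fin n)} {α : Fin n ≃ Fin n} {s s' : State}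
    (h : Represents G α s) (hn : s'.reg regN = s.reg regN) (ha : s'.arr = s.arr) :
    Represents G α s' := by
  simpa only [Represents, hn, ha] using h

theorem Represents.setEntry {n : ℕ} {G : SimpleGraph (Fin n)} {α : Fin n ≃ Fin n} {s : State}
    {u v : Fin n} (huv : u ≠ v) (h : Represents G α s) :
    Represents (G ⊔ SimpleGraph.edge u v) α
      ((s.setArr arrM ((α.symm u).val + 1) ((α.symm v).val + 1) 1).setArr arrM
        ((α.symm v).val + 1) ((α.symm u).val + 1) 1) := by
  obtain ⟨hn, hord, hpos, hM, hM0⟩ := h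
  refine ⟨hn, fun i => by simp [hord], fun v => by simp [hpos], fun i j => ?_, fun a b hab => ?_⟩
  · rw [nbhdMatrix_sup_edge G α huv]
    simp only [State.setArr_arr, hM, SCG.setEntry, Matrix.of_apply, Nat.add_right_cancel_iff,
      true_and, Fin.val_inj]
    split_ifs <;> tauto
  · have hu := (α.symm u).isLt
    have hv := (α.symm v).isLt
    simp only [State.setArr_arr, hM0 a b hab, true_and]
    rw [if_neg (by omega), if_neg (by omega)]

theorem insertEdge_spec {n : ℕ} {G : SimpleGraph (Fin n)} {α : Fin n ≃ Fin n} {u v : Fin n}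
    {s : State} (hα : IsStrongElimOrdering G α) (huv : u ≠ v) (hs : Represents G α s)
    (hu : s.reg regU = u.val + 1) (hv : s.reg regV = v.val + 1) :
    ∃ (t₁ t₂ : ℕ) (s₁ s₂ : State),
      Exec insertQuery s t₁ s₁ ∧ t₁ ≤ 1000 * n ^ 2 ∧
      Exec updateMatrix s₁ t₂ s₂ ∧ t₂ ≤ 1000 ∧
      Exec insertEdge s (t₁ + t₂) s₂ ∧
      Represents G α s₁ ∧
      ((¬ G.Adj u v ∧
          ¬ HasDelta (setEntry (nbhdMatrix G α) (α.symm u) (α.symm v)) ∧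
          s₁.reg regCan = 1 ∧
          IsStrongElimOrdering (G ⊔ SimpleGraph.edge u v) α ∧
          IsStronglyChordal (G ⊔ SimpleGraph.edge u v) ∧
          Represents (G ⊔ SimpleGraph.edge u v) α s₂) ∨
        ((G.Adj u v ∨ HasDelta (setEntry (nbhdMatrix G α) (α.symm u) (α.symm v))) ∧
          s₁.reg regCan = 0 ∧ Represents G α s₂)) := by
  obtain ⟨t₁, s₁, h1, ht, hi, hj, hr⟩ := Runs.insertQuery hα huv hs hu hv
  have hs₁ : Represents G α s₁ :=
    hs.congr (h1.preserves.1 regN rfl) (funext fun A => h1.preserves.2 A rfl)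
  rcases hr with ⟨hc, hno⟩ | ⟨hc, hyes⟩
  · have hadd := isStrongElimOrdering_sup_edge huv (fun h => hno (Or.inr h))
    have h2 : Exec updateMatrix s₁ _ _ :=
      .branch_true (by simp [Test.holds, Expr.eval, hc]) (.seq (.store ..) (.store ..))
    refine ⟨t₁, _, s₁, _, h1, ht, h2, by decide, .seq h1 h2, hs₁, Or.inl ⟨fun h => hno (Or.inl h),
      fun h => hno (Or.inr h), hc, hadd, ⟨n, α, hadd⟩, ?_⟩⟩
    simp only [Expr.eval, State.setArr_reg, hi, hj]
    exact hs₁.setEntry huv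
  · have h2 : Exec updateMatrix s₁ _ _ :=
      .branch_false (by simp [Test.holds, Expr.eval, hc]) (.skip s₁)
    exact ⟨t₁, _, s₁, _, h1, ht, h2, by decide, .seq h1 h2, hs₁, Or.inr ⟨hyes, hc, hs₁⟩⟩

/-! ### Computing a strong elimination ordering -/

/-- The closed neighbours of `x` within `S`, for a graph on natural numbers whose closed adjacency
relation is `A · · = 1`. -/
def nbrs (A : ℕ → ℕ → ℕ) (S : Finset ℕ) (x : ℕ) : Finset ℕ := S.filter fun z => A z x = 1

theorem mem_nbrs {A : ℕ → ℕ → ℕ} {S : Finset ℕ} {x z : ℕ} :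
    z ∈ nbrs A S x ↔ z ∈ S ∧ A z x = 1 := by
  simp [nbrs]

theorem nbrs_subset_nbrs_of_subset {A : ℕ → ℕ → ℕ} {S S' : Finset ℕ} (hS : S' ⊆ S) {x y : ℕ}
    (h : nbrs A S x ⊆ nbrs A S y) : nbrs A S' x ⊆ nbrs A S' y := by
  intro z hz
  rw [mem_nbrs] at hz ⊢
  exact ⟨hz.1, (mem_nbrs.1 (h (mem_nbrs.2 ⟨hS hz.1, hz.2⟩))).2⟩

/-- `v` is a simple vertex of the graph induced on `S`: the closed neighbourhoods of its closed
neighbours form a chain. -/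
def IsSimple (A : ℕ → ℕ → ℕ) (S : Finset ℕ) (v : ℕ) : Prop :=
  ∀ x ∈ nbrs A S v, ∀ y ∈ nbrs A S v, nbrs A S x ⊆ nbrs A S y ∨ nbrs A S y ⊆ nbrs A S x

instance (A : ℕ → ℕ → ℕ) (S : Finset ℕ) : DecidablePred (IsSimple A S) := fun v => by
  unfold IsSimple; infer_instance

theorem IsSimple.of_nbrs_subset {A : ℕ → ℕ → ℕ} {S : Finset ℕ} {u v : ℕ} (hv : IsSimple A S v)
    (h : nbrs A S u ⊆ nbrs A S v) : IsSimple A S u :=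
  fun x hx y hy => hv x (h hx) y (h hy)

/-- The elements of `L` that belong to `S`, stably sorted by the number of their closed neighbours
in `S` (a number between `1` and `n`, so that nothing else is lost). -/
def sortByDegree (A : ℕ → ℕ → ℕ) (n : ℕ) (S : Finset ℕ) (L : List ℕ) : List ℕ :=
  (List.range' 1 n).flatMap fun d => L.filter fun x => x ∈ S ∧ (nbrs A S x).card = d

/-- The first simple vertex in `L`, or `0`, which is not a vertex, if there is none. -/
def firstSimple (A : ℕ → ℕ → ℕ) (S : Finset ℕ) (L : List ℕ) : ℕ :=
  (L.find? fun v => IsSimple A S v).getD 0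

/-- The set of the vertices left after `k` eliminations, together with the list from which the last
of the eliminated vertices was chosen (initially, the list of all vertices): in each round the list
is sorted anew, and its first simple vertex is eliminated. -/
def elimination (A : ℕ → ℕ → ℕ) (n : ℕ) : ℕ → Finset ℕ × List ℕ
  | 0 => (Finset.Icc 1 n, List.range' 1 n)
  | k + 1 =>
    let S := (elimination A n k).1
    let L := sortByDegree A n S (elimination A n k).2
    (S.erase (firstSimple A S L), L)

/-- The vertices left after `k` eliminations. -/
def alive (A : ℕ → ℕ → ℕ) (n k : ℕ) : Finset ℕ := (elimination A n k).1

/-- `queue A n (k + 1)` is the list from which the vertex of round `k` is chosen (the rounds are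
numbered from `0`), and `queue A n 0` lists all vertices. -/
def queue (A : ℕ → ℕ → ℕ) (n k : ℕ) : List ℕ := (elimination A n k).2

/-- The vertex eliminated in round `k`. -/
def pick (A : ℕ → ℕ → ℕ) (n k : ℕ) : ℕ := firstSimple A (alive A n k) (queue A n (k + 1))

section Elimination

variable {A : ℕ → ℕ → ℕ} {n : ℕ}

theorem queue_succ (k : ℕ) :
    queue A n (k + 1) = sortByDegree A n (alive A n k) (queue A n k) := rfl

theorem alive_succ (k : ℕ) : alive A n (k + 1) = (alive A n k).erase (pick A n k) := rfl

theorem alive_anti {j k : ℕ} (hjk : j ≤ k) : alive A n k ⊆ alive A n j := by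
  induction hjk with
  | refl => exact subset_rfl
  | step _ ih => exact (Finset.erase_subset _ _).trans ih

theorem alive_subset (k : ℕ) : alive A n k ⊆ Finset.Icc 1 n := alive_anti (Nat.zero_le k)

theorem card_nbrs_le {k x : ℕ} : (nbrs A (alive A n k) x).card ≤ n := by
  refine (Finset.card_le_card ((Finset.filter_subset _ _).trans (alive_subset k))).trans ?_
  simp

theorem mem_sortByDegree {S : Finset ℕ} {L : List ℕ} {x : ℕ} :
    x ∈ sortByDegree A n S L ↔
      (1 ≤ (nbrs A S x).card ∧ (nbrs A S x).card ≤ n) ∧ x ∈ L ∧ x ∈ S := by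
  simp only [sortByDegree, List.mem_flatMap, List.mem_range'_1, List.mem_filter, decide_eq_true_eq]
  grind

theorem mem_queue_succ (hrefl : ∀ x ∈ Finset.Icc 1 n, A x x = 1) (k x : ℕ) :
    x ∈ queue A n (k + 1) ↔ x ∈ alive A n k := by
  rw [queue_succ, mem_sortByDegree]
  refine ⟨fun h => h.2.2, fun h => ⟨⟨?_, card_nbrs_le⟩, ?_, h⟩⟩
  · exact Finset.card_pos.2 ⟨x, mem_nbrs.2 ⟨h, hrefl x (alive_subset k h)⟩⟩
  · cases k with
    | zero =>
      have := Finset.mem_Icc.1 (alive_subset 0 h)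
      simp only [queue, elimination, List.mem_range'_1]
      omega
    | succ k => exact (mem_queue_succ hrefl k x).2 (alive_anti (Nat.le_succ k) h)

theorem queue_subset (hrefl : ∀ x ∈ Finset.Icc 1 n, A x x = 1) {k x : ℕ}
    (hx : x ∈ queue A n k) : x ∈ Finset.Icc 1 n := by
  cases k with
  | zero =>
    simp only [queue, elimination, List.mem_range'_1] at hx
    rw [Finset.mem_Icc]
    omega
  | succ k => exact alive_subset k ((mem_queue_succ hrefl k x).1 hx)

/-- Since the sorting is stable, two vertices of the same degree keep their order in `L`, where they
are known to satisfy `R`; any other two vertices come in the order of their degrees. -/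
theorem pairwise_sortByDegree {S : Finset ℕ} {L : List ℕ} {R R' : ℕ → ℕ → Prop}
    (hL : L.Pairwise R)
    (heq : ∀ x ∈ S, ∀ y ∈ S, (nbrs A S x).card = (nbrs A S y).card → R x y → R' x y)
    (hlt : ∀ x ∈ S, ∀ y ∈ S, (nbrs A S x).card < (nbrs A S y).card → R' x y) :
    (sortByDegree A n S L).Pairwise R' := by
  rw [sortByDegree, List.pairwise_flatMap]
  constructor
  · intro d _
    refine (hL.filter _).imp_of_mem fun {x y} hx hy hxy => ?_
    simp only [List.mem_filter, decide_eq_true_eq] at hx hy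
    exact heq x hx.2.1 y hy.2.1 (hx.2.2.trans hy.2.2.symm) hxy
  · refine (List.pairwise_lt_range' (s := 1) (n := n)).imp fun {d e} hde x hx y hy => ?_
    simp only [List.mem_filter, decide_eq_true_eq] at hx hy
    exact hlt x hx.2.1 y hy.2.1 (by omega)

theorem nodup_queue (k : ℕ) : (queue A n k).Nodup := by
  induction k with
  | zero => exact List.nodup_range'
  | succ k ih =>
    rw [queue_succ]
    exact pairwise_sortByDegree ih (fun _ _ _ _ _ h => h) fun x _ y _ h e => by simp [e] at h

theorem length_queue_le (hrefl : ∀ x ∈ Finset.Icc 1 n, A x x = 1) (k : ℕ) :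
    (queue A n k).length ≤ n := by
  rw [← List.toFinset_card_of_nodup (nodup_queue k)]
  refine (Finset.card_le_card (t := Finset.Icc 1 n) fun x hx => ?_).trans (by simp)
  exact queue_subset hrefl (List.mem_toFinset.1 hx)

theorem pairwise_card_queue_succ (k : ℕ) :
    (queue A n (k + 1)).Pairwise fun x y =>
      (nbrs A (alive A n k) x).card ≤ (nbrs A (alive A n k) y).card :=
  pairwise_sortByDegree (List.pairwise_of_forall (R := fun _ _ => True) fun _ _ => trivial)
    (fun _ _ _ _ h _ => h.le) fun _ _ _ _ h => h.le

/-- If the neighbourhood of `y` was properly contained in that of `x` in an earlier round, then `y`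
precedes `x`: containment persists under the removal of vertices, so that the degree of `y` is never
above that of `x` again, and ties are not reordered. -/
theorem pairwise_queue (k : ℕ) :
    (queue A n k).Pairwise fun x y =>
      ∀ j < k, ¬ nbrs A (alive A n j) y ⊂ nbrs A (alive A n j) x := by
  induction k with
  | zero => exact List.pairwise_of_forall fun _ _ j hj => absurd hj (Nat.not_lt_zero j)
  | succ k ih =>
    rw [queue_succ]
    refine pairwise_sortByDegree ih (fun x _ y _ h hxy j hj hss => ?_) fun x _ y _ h j hj hss => ?_
    · rcases Nat.lt_succ_iff_lt_or_eq.1 hj with hj | rfl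
      · exact hxy j hj hss
      · exact (Finset.card_lt_card hss).ne h.symm
    · exact absurd (Finset.card_le_card (nbrs_subset_nbrs_of_subset
        (alive_anti (Nat.le_of_lt_succ hj)) hss.1)) (not_le.2 h)

/-- If the vertices are listed by increasing degree, it is enough to compare the neighbourhoods of
consecutive neighbours of `v` in order to see whether `v` is simple. -/
theorem isSimple_iff_isChain {S : Finset ℕ} {L : List ℕ} (hsymm : ∀ x y, A x y = A y x)
    (hmem : ∀ x, x ∈ L ↔ x ∈ S)
    (hL : L.Pairwise fun x y => (nbrs A S x).card ≤ (nbrs A S y).card) (v : ℕ) :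
    IsSimple A S v ↔
      (L.filter fun x => A v x = 1).IsChain fun x y => nbrs A S x ⊆ nbrs A S y := by
  have : IsTrans ℕ fun x y => nbrs A S x ⊆ nbrs A S y := ⟨fun _ _ _ h h' => h.trans h'⟩
  rw [List.isChain_iff_pairwise]
  have hmem' : ∀ x, x ∈ (L.filter fun x => A v x = 1) ↔ x ∈ nbrs A S v := by
    intro x
    rw [List.mem_filter, hmem, mem_nbrs, hsymm v x, decide_eq_true_eq]
  constructor
  · intro h
    refine (hL.filter _).imp_of_mem fun {x y} hx hy hxy => ?_
    rcases h x ((hmem' x).1 hx) y ((hmem' y).1 hy) with h' | h'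
    · exact h'
    · exact (Finset.eq_of_subset_of_card_le h' hxy).ge
  · intro h x hx y hy
    exact List.Pairwise.forall_of_forall_of_flip
      (R := fun x y => nbrs A S x ⊆ nbrs A S y ∨ nbrs A S y ⊆ nbrs A S x)
      (fun _ _ => Or.inl subset_rfl) (h.imp Or.inl) (h.imp Or.inr) ((hmem' x).2 hx)
      ((hmem' y).2 hy)

theorem pick_spec (hrefl : ∀ x ∈ Finset.Icc 1 n, A x x = 1) {k : ℕ}
    (h : ∃ v ∈ alive A n k, IsSimple A (alive A n k) v) :
    pick A n k ∈ alive A n k ∧ IsSimple A (alive A n k) (pick A n k) ∧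
      ∃ L L', queue A n (k + 1) = L ++ pick A n k :: L' ∧ ∀ y ∈ L, ¬ IsSimple A (alive A n k) y := by
  obtain ⟨v, hv, hsv⟩ := h
  rw [← mem_queue_succ hrefl] at hv
  have hsome : ((queue A n (k + 1)).find? fun v => IsSimple A (alive A n k) v).isSome := by
    rw [List.find?_isSome]
    exact ⟨v, hv, by simpa using hsv⟩
  obtain ⟨w, hw⟩ := Option.isSome_iff_exists.1 hsome
  have hpick : pick A n k = w := by simp [pick, firstSimple, hw]
  rw [hpick, ← mem_queue_succ hrefl]
  refine ⟨List.mem_of_find?_eq_some hw, by simpa using List.find?_some hw, ?_⟩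
  obtain ⟨-, L, L', h1, h2⟩ := List.find?_eq_some_iff_append.1 hw
  exact ⟨L, L', h1, fun y hy => by simpa using h2 y hy⟩

/-- `A · · = 1` is the closed adjacency relation of a graph with vertices `1, …, n` of which every
nonempty induced subgraph has a simple vertex. -/
structure HasSimpleVertices (A : ℕ → ℕ → ℕ) (n : ℕ) : Prop where
  symm : ∀ x y, A x y = A y x
  refl : ∀ x ∈ Finset.Icc 1 n, A x x = 1
  mem : ∀ x y, A x y = 1 → x ∈ Finset.Icc 1 n
  exists_isSimple : ∀ S ⊆ Finset.Icc 1 n, S.Nonempty → ∃ v ∈ S, IsSimple A S v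

theorem card_alive (hA : HasSimpleVertices A n) {k : ℕ} (hk : k ≤ n) : (alive A n k).card = n - k := by
  induction k with
  | zero => simp [alive, elimination]
  | succ k ih =>
    have hk' := ih (by omega)
    have hne : (alive A n k).Nonempty := Finset.card_pos.1 (by omega)
    rw [alive_succ, Finset.card_erase_of_mem
      (pick_spec hA.refl (hA.exists_isSimple _ (alive_subset k) hne)).1]
    omega

theorem exists_isSimple_alive (hA : HasSimpleVertices A n) {k : ℕ} (hk : k < n) :
    ∃ v ∈ alive A n k, IsSimple A (alive A n k) v := by
  refine hA.exists_isSimple _ (alive_subset k) (Finset.card_pos.1 ?_)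
  rw [card_alive hA hk.le]
  omega

theorem pick_mem_alive (hA : HasSimpleVertices A n) {j k : ℕ} (hjk : j ≤ k) (hk : k < n) : pick A n k ∈ alive A n j :=
  alive_anti hjk (pick_spec hA.refl (exists_isSimple_alive hA hk)).1

theorem pick_ne_pick (hA : HasSimpleVertices A n) {j k : ℕ} (hjk : j < k) (hk : k < n) : pick A n j ≠ pick A n k := by
  intro h
  have := pick_mem_alive hA (Nat.succ_le_of_lt hjk) hk
  rw [alive_succ, h] at this
  simp at this

/-- The neighbourhood of the vertex eliminated in round `k` has at no time properly contained that of
a vertex which is left: such a vertex would be simple, too, and would precede it in the list. -/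
theorem not_nbrs_ssubset_nbrs_pick (hA : HasSimpleVertices A n) {j k : ℕ} (hjk : j ≤ k)
    (hk : k < n) {y : ℕ}
    (hy : y ∈ alive A n (k + 1)) :
    ¬ nbrs A (alive A n j) y ⊂ nbrs A (alive A n j) (pick A n k) := by
  intro hss
  obtain ⟨-, hs, L, L', hL, hno⟩ := pick_spec hA.refl (exists_isSimple_alive hA hk)
  have hys := hs.of_nbrs_subset (nbrs_subset_nbrs_of_subset (alive_anti hjk) hss.1)
  rw [alive_succ, Finset.mem_erase] at hy
  have hyq := (mem_queue_succ hA.refl k y).2 hy.2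
  have hpw := pairwise_queue (A := A) (n := n) (k + 1)
  rw [hL] at hyq hpw
  rcases List.mem_append.1 hyq with h | h
  · exact hno y h hys
  · have hyL' := (List.mem_cons.1 h).resolve_left hy.1
    exact (List.pairwise_cons.1 (List.pairwise_append.1 hpw).2.1).1 y hyL' j
      (Nat.lt_succ_of_le hjk) hss

theorem mem_alive {k x : ℕ} :
    x ∈ alive A n k ↔ x ∈ Finset.Icc 1 n ∧ ∀ j < k, pick A n j ≠ x := by
  induction k with
  | zero => simp [alive, elimination]
  | succ k ih =>
    rw [alive_succ, Finset.mem_erase, ih]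
    constructor
    · rintro ⟨h1, h2, h3⟩
      refine ⟨h2, fun j hj => ?_⟩
      rcases Nat.lt_succ_iff_lt_or_eq.1 hj with hj | rfl
      · exact h3 j hj
      · exact h1.symm
    · rintro ⟨h1, h2⟩
      exact ⟨(h2 k (Nat.lt_succ_self k)).symm, h1, fun j hj => h2 j (Nat.lt_succ_of_lt hj)⟩

/-- The vertices are eliminated in the order of a strong elimination ordering. -/
theorem pick_strong (hA : HasSimpleVertices A n) {i j k l : ℕ} (hij : i < j) (hkl : k < l)
    (hj : j < n) (hl : l < n)
    (hki : A (pick A n k) (pick A n i) = 1) (hli : A (pick A n l) (pick A n i) = 1)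
    (hkj : A (pick A n k) (pick A n j) = 1) : A (pick A n l) (pick A n j) = 1 := by
  have key : ∀ i j k l : ℕ, i < j → k < l → j < n → l < n → i ≤ k →
      A (pick A n k) (pick A n i) = 1 → A (pick A n l) (pick A n i) = 1 →
      A (pick A n k) (pick A n j) = 1 → A (pick A n l) (pick A n j) = 1 := by
    intro i j k l hij hkl hj hl hik hki hli hkj
    have hmem := fun m (hm : i ≤ m) (hmn : m < n) => pick_mem_alive hA hm hmn
    have hs := (pick_spec hA.refl (exists_isSimple_alive hA (hij.trans hj))).2.1
    have hsub : nbrs A (alive A n i) (pick A n k) ⊆ nbrs A (alive A n i) (pick A n l) := by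
      by_contra hno
      refine not_nbrs_ssubset_nbrs_pick hA hik (hkl.trans hl)
        (pick_mem_alive hA hkl hl) ⟨?_, hno⟩
      exact (hs _ (mem_nbrs.2 ⟨hmem k hik (hkl.trans hl), hki⟩) _
        (mem_nbrs.2 ⟨hmem l (hik.trans hkl.le) hl, hli⟩)).resolve_left hno
    rw [hA.symm]
    exact (mem_nbrs.1 (hsub (mem_nbrs.2 ⟨hmem j hij.le hj, by rwa [hA.symm]⟩))).2
  rcases le_or_gt i k with h | h
  · exact key i j k l hij hkl hj hl h hki hli hkj
  · -- The condition is symmetric under the exchange of rows and columns.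
    rw [hA.symm]
    rw [hA.symm] at hki hli hkj
    exact key k l i j hkl hij hl hj h.le hki hkj hli

end Elimination

/-! ### The preprocessing program -/

/-- The number of the round, from `1` to `n`. -/
abbrev regRound : ℕ := 4
/-- Registers `regX`, `regY`, `regZ` serve as loop variables. -/
abbrev regX : ℕ := 5
abbrev regY : ℕ := 6
abbrev regZ : ℕ := 7
/-- The next free cell of the list which is being built. -/
abbrev regFree : ℕ := 8
/-- The first simple vertex found so far. -/
abbrev regPick : ℕ := 9
/-- The vertex which is tested for being simple. -/
abbrev regCand : ℕ := 10
/-- The last neighbour of `regCand` met in the list. -/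
abbrev regLast : ℕ := 11
/-- `1` as long as the neighbourhoods of the neighbours of `regCand` form a chain. -/
abbrev regOk : ℕ := 12

/-- The cell `[x][y]` counts the vertices left which are in `N[x]` but not in `N[y]`. As `0` is
not a vertex, `N[0]` is empty, and the cell `[x][0]` counts all vertices left in `N[x]`. -/
abbrev arrDiff : ℕ := 4
/-- The rows of this array hold the sorted lists of successive rounds, padded with zeros; round `i`
reads row `i` and writes row `i + 1`. -/
abbrev arrList : ℕ := 5

/-- `Adj[e][f] == 1`, where `Adj` has been made reflexive. -/
def adjacent (e f : Expr) : Test := .eq (.get arrAdj e f) (.lit 1)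

/-- Run `p` for all `x = 1, …, n` and `y = 0, …, n`. Column `0` is included because `arrDiff` has the
degrees there. -/
def forCells (p : Prog) : Prog := forUp regX (.lit 1) (forUp regY (.lit 0) p)

/-- Make the adjacency matrix reflexive, and list all vertices in the first row of `arrList`. -/
def initArrays : Prog :=
  forUp regX (.lit 1) <|
    .seq (.store arrAdj (.var regX) (.var regX) (.lit 1))
      (.store arrList (.lit 1) (.var regX) (.var regX))

/-- Compute the initial contents of `arrDiff`. -/
def countDiffs : Prog :=
  forCells <| forUp regZ (.lit 1) <|
    .branch (.conj (adjacent (.var regZ) (.var regX)) (.neg (adjacent (.var regZ) (.var regY))))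
      (.store arrDiff (.var regX) (.var regY) (.succ (.get arrDiff (.var regX) (.var regY)))) .skip

/-- The entry number `regY` of the current list. -/
def listEntry : Expr := .get arrList (.var regRound) (.var regY)

/-- Stable bucket sort by degree: for each degree, append the vertices of this degree to the next
list. The eliminated vertices, whose positions are set already, are left out. -/
def sortRound : Prog :=
  .seq (.assign regFree (.lit 1)) <|
    forUp regX (.lit 1) <| forUp regY (.lit 1) <|
      .branch (.conj (.eq (.get arrPos (.lit 0) listEntry) (.lit 0))
          (.eq (.get arrDiff listEntry (.lit 0)) (.var regX)))
        (.seq (.store arrList (.succ (.var regRound)) (.var regFree) listEntry)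
          (.assign regFree (.succ (.var regFree)))) .skip

/-- Set `regOk` to `1` if the neighbours of `regCand` have increasing neighbourhoods in the order of
the new list. -/
def testSimple : Prog :=
  .seq (.assign regOk (.lit 1)) <| .seq (.assign regLast (.lit 0)) <|
    forUp regX (.lit 1) <|
      .seq (.assign regY (.get arrList (.succ (.var regRound)) (.var regX))) <|
        .branch (adjacent (.var regCand) (.var regY))
          (.seq
            (.branch (.eq (.get arrDiff (.var regLast) (.var regY)) (.lit 0)) .skip
              (.assign regOk (.lit 0)))
            (.assign regLast (.var regY))) .skip

/-- Find the first simple vertex of the new list, passing through the list from its end. The padding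
is harmless: `0` passes the test, but is overwritten by the simple vertices that follow. -/
def chooseVertex : Prog :=
  .seq (.assign regPick (.lit 0)) <|
    forDown regZ (.var regN) <|
      .seq (.assign regCand (.get arrList (.succ (.var regRound)) (.var regZ))) <|
        .seq testSimple
          (.branch (.eq (.var regOk) (.lit 1)) (.assign regPick (.var regCand)) .skip)

/-- Append the chosen vertex to the ordering, and remove it from the counts in `arrDiff`. -/
def removeVertex : Prog :=
  .seq (.store arrOrd (.lit 0) (.var regRound) (.var regPick)) <|
    .seq (.store arrPos (.lit 0) (.var regPick) (.var regRound)) <|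
      forCells <|
        .branch (.conj (adjacent (.var regPick) (.var regX))
            (.neg (adjacent (.var regPick) (.var regY))))
          (.store arrDiff (.var regX) (.var regY)
            (.pred (.get arrDiff (.var regX) (.var regY)))) .skip

/-- Permute the rows and columns of the reflexive adjacency matrix. -/
def fillMatrix : Prog :=
  forCells <| .store arrM (.var regX) (.var regY)
    (.get arrAdj (.get arrOrd (.lit 0) (.var regX)) (.get arrOrd (.lit 0) (.var regY)))

/-- The preprocessing. `regCan` must be `1` for the loops to run. -/
def preprocess : Prog :=
  .seq (.assign regCan (.lit 1)) <| .seq initArrays <| .seq countDiffs <|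
    .seq (forUp regRound (.lit 1) (.seq sortRound (.seq chooseVertex removeVertex))) fillMatrix

/-! ### Correctness of the preprocessing program -/

/-- A loop whose body does not touch `regCan` runs through its whole range. -/
theorem Runs.forUp_all {x : ℕ} {e : Expr} {p : Prog} {T n a : ℕ} {s : State}
    {I : ℕ → State → Prop} (hxp : p.writesReg x = false) (hnp : p.writesReg regN = false)
    (hcp : p.writesReg regCan = false) (hxN : x ≠ regN) (hxc : x ≠ regCan)
    (hn : s.reg regN = n) (hc : s.reg regCan = 1) (ha : e.eval s = a) (han : a ≤ n + 1)
    (h0 : I a (s.setReg x a))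
    (hstep : ∀ k s', a ≤ k → k ≤ n → s'.reg x = k → s'.reg regN = n → s'.reg regCan = 1 →
      Preserves (SCG.forUp x e p) s s' → I k s' →
      Runs p T s' fun s'' => I (k + 1) (s''.setReg x (k + 1))) :
    Runs (SCG.forUp x e p) (e.cost + 8 + (n + 1) * (T + 10)) s fun s' => I (n + 1) s' := by
  refine (Runs.forUp hxp hnp hxN hn ha han h0 hstep).mono (by gcongr; omega) ?_
  rintro s' hp ⟨k, -, -, -, hI, h⟩
  have : s'.reg regCan = 1 := by
    rw [hp.1 regCan, hc]
    simp [SCG.forUp, Prog.writesReg, hcp, hxc]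
  rcases h with rfl | h
  · exact hI
  · exact absurd this h

/-- If the body sets the cell `[x][y]` of the array `B` to `g x y`, the double loop does so for all
cells in its range. -/
theorem Runs.forCells {B : ℕ} {p : Prog} {T n : ℕ} {s : State} {g : ℕ → ℕ → ℕ}
    (hX : p.writesReg regX = false) (hY : p.writesReg regY = false)
    (hN : p.writesReg regN = false) (hC : p.writesReg regCan = false)
    (hn : s.reg regN = n) (hc : s.reg regCan = 1)
    (hstep : ∀ a b s', 1 ≤ a → a ≤ n → b ≤ n → s'.reg regX = a → s'.reg regY = b →
      Preserves (SCG.forCells p) s s' → s'.arr B a b = s.arr B a b →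
      Runs p T s' fun s'' => ∀ a' b',
        s''.arr B a' b' = if a' = a ∧ b' = b then g a b else s'.arr B a' b') :
    Runs (SCG.forCells p) (9 + (n + 1) * (19 + (n + 1) * (T + 10))) s fun s' =>
      ∀ a b, s'.arr B a b = if (1 ≤ a ∧ a ≤ n) ∧ b ≤ n then g a b else s.arr B a b := by
  have hX' : (SCG.forUp regY (.lit 0) p).writesReg regX = false := by
    simp [SCG.forUp, Prog.writesReg, hX]
  have hN' : (SCG.forUp regY (.lit 0) p).writesReg regN = false := by
    simp [SCG.forUp, Prog.writesReg, hN]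
  have hC' : (SCG.forUp regY (.lit 0) p).writesReg regCan = false := by
    simp [SCG.forUp, Prog.writesReg, hC]
  refine (Runs.forUp_all (a := 1) (T := 9 + (n + 1) * (T + 10))
    (I := fun k s' => ∀ a b,
      s'.arr B a b = if (1 ≤ a ∧ a < k) ∧ b ≤ n then g a b else s.arr B a b)
    hX' hN' hC' (by decide) (by decide) hn hc rfl (by omega) ?_ ?_).mono (le_of_eq ?_) ?_
  · intro a b
    rw [if_neg (by omega)]; rfl
  · intro a s₁ ha1 han hxa hn₁ hc₁ hp₁ hI₁
    refine (Runs.forUp_all (a := 0) (T := T) (I := fun k s' => ∀ a' b,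
      s'.arr B a' b = if ((1 ≤ a' ∧ a' < a) ∧ b ≤ n) ∨ (a' = a ∧ b < k) then g a' b
        else s.arr B a' b) hY hN hC (by decide) (by decide) hn₁ hc₁ rfl (by omega) ?_ ?_).mono
        le_rfl ?_
    · intro a' b
      simp only [State.setReg_arr, hI₁, not_lt_zero, and_false, or_false]
    · intro b s₂ _ hbn hyb hn₂ hc₂ hp₂ hI₂
      refine (hstep a b s₂ ha1 han hbn ((hp₂.1 regX hX').trans hxa) hyb
        (hp₁.trans (hp₂.mono ?_ ?_)) ?_).mono le_rfl ?_
      · simp +contextual [SCG.forUp, Prog.writesReg]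
      · simp +contextual [SCG.forUp, Prog.writesArr]
      · rw [hI₂, if_neg (by omega)]
      · intro s₃ _ h a' b'
        simp only [State.setReg_arr, h, hI₂]
        by_cases hab : a' = a ∧ b' = b
        · obtain ⟨rfl, rfl⟩ := hab
          simp
        · rw [if_neg hab]
          refine if_congr ?_ rfl rfl
          omega
    · intro s₂ _ h a' b
      simp only [State.setReg_arr, h]
      refine if_congr ?_ rfl rfl
      omega
  · simp only [Expr.cost]; ring
  · intro s' _ h a b
    simp only [h, Nat.lt_succ_iff]

/-- The closed adjacency relation of `G` on the vertex numbers `1, …, n`, as a `0`-`1` matrix. -/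
noncomputable def reflAdj {n : ℕ} (G : SimpleGraph (Fin n)) : ℕ → ℕ → ℕ := fun a b =>
  open Classical in
  if ∃ u v : Fin n, u ∈ closedNbhd G v ∧ a = u.val + 1 ∧ b = v.val + 1 then 1 else 0

theorem reflAdj_eq_one {n : ℕ} {G : SimpleGraph (Fin n)} {u v : Fin n} :
    reflAdj G (u.val + 1) (v.val + 1) = 1 ↔ u ∈ closedNbhd G v := by
  simp [reflAdj, Fin.val_inj]

theorem reflAdj_eq_zero {n : ℕ} {G : SimpleGraph (Fin n)} {a b : ℕ} (h : reflAdj G a b ≠ 1) :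
    reflAdj G a b = 0 := by
  unfold reflAdj at h ⊢
  split_ifs at h ⊢ <;> simp_all

theorem mem_Icc_iff_exists_fin {n x : ℕ} : x ∈ Finset.Icc 1 n ↔ ∃ u : Fin n, u.val + 1 = x := by
  rw [Finset.mem_Icc]
  constructor
  · rintro ⟨h1, h2⟩
    exact ⟨⟨x - 1, by omega⟩, by simp only; omega⟩
  · rintro ⟨u, rfl⟩
    omega

/-- In a strongly chordal graph, the first vertex of a set in a strong elimination ordering is
simple in the graph induced on the set. -/
theorem hasSimpleVertices_reflAdj {n : ℕ} {G : SimpleGraph (Fin n)} (hG : IsStronglyChordal G) :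
    HasSimpleVertices (reflAdj G) n := by
  have hmem : ∀ x y, reflAdj G x y = 1 →
      ∃ u v : Fin n, u ∈ closedNbhd G v ∧ x = u.val + 1 ∧ y = v.val + 1 := by
    intro x y h
    by_contra hno
    simp [reflAdj, hno] at h
  have hsymm : ∀ x y, reflAdj G x y = reflAdj G y x := by
    intro x y
    simp only [reflAdj]
    congr 1
    refine propext ⟨?_, ?_⟩ <;>
      exact fun ⟨u, v, h1, h2, h3⟩ => ⟨v, u, mem_closedNbhd_comm.1 h1, h3, h2⟩
  refine ⟨hsymm, ?_, ?_, ?_⟩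
  · intro x hx
    obtain ⟨u, rfl⟩ := mem_Icc_iff_exists_fin.1 hx
    exact reflAdj_eq_one.2 (mem_closedNbhd.2 (Or.inl rfl))
  · intro x y h
    obtain ⟨u, v, -, rfl, -⟩ := hmem x y h
    exact mem_Icc_iff_exists_fin.2 ⟨u, rfl⟩
  · obtain ⟨m, β, hβ⟩ := hG
    intro S hS hne
    have hfin : ∀ x : S, ∃ u : Fin n, u.val + 1 = x := fun x =>
      mem_Icc_iff_exists_fin.1 (hS x.2)
    choose f hf using hfin
    have : Nonempty S := hne.to_subtype
    obtain ⟨v, hv⟩ := Finite.exists_min fun x : S => β.symm (f x)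
    have hadj : ∀ x y : S, reflAdj G x y = 1 ↔ f x ∈ closedNbhd G (f y) := by
      intro x y
      rw [← reflAdj_eq_one, hf, hf]
    have key : ∀ x y : S, x.1 ∈ nbrs (reflAdj G) S v → y.1 ∈ nbrs (reflAdj G) S v →
        β.symm (f x) < β.symm (f y) → nbrs (reflAdj G) S x ⊆ nbrs (reflAdj G) S y := by
      intro x y hx hy hxy z hz
      rw [mem_nbrs] at hx hy hz ⊢
      obtain ⟨hzS, hzx⟩ := hz
      lift z to S using hzS
      refine ⟨z.2, ?_⟩
      rw [hadj] at hzx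
      have hx' := (hadj _ _).1 hx.2
      have hy' := (hadj _ _).1 hy.2
      rw [hadj, mem_closedNbhd_comm]
      rcases (hv z).lt_or_eq with h | h
      · have := hβ _ _ _ _ h hxy
        simp only [Equiv.apply_symm_apply] at this
        exact this hx' hy' (mem_closedNbhd_comm.1 hzx)
      · rwa [← β.symm.injective h]
    refine ⟨v, v.2, fun x hx y hy => ?_⟩
    lift x to S using (mem_nbrs.1 hx).1
    lift y to S using (mem_nbrs.1 hy).1
    rcases lt_trichotomy (β.symm (f x)) (β.symm (f y)) with h | h | h
    · exact Or.inl (key x y hx hy h)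
    · refine Or.inl (le_of_eq ?_)
      rw [← hf x, ← hf y, β.symm.injective h]
    · exact Or.inr (key y x hy hx h)

/-- The number of vertices of `S` which are in `N[x]` but not in `N[y]`. -/
def diffCount (A : ℕ → ℕ → ℕ) (S : Finset ℕ) (x y : ℕ) : ℕ := (nbrs A S x \ nbrs A S y).card

theorem diffCount_eq_zero {A : ℕ → ℕ → ℕ} {S : Finset ℕ} {x y : ℕ} :
    diffCount A S x y = 0 ↔ nbrs A S x ⊆ nbrs A S y := by
  rw [diffCount, Finset.card_eq_zero, Finset.sdiff_eq_empty_iff_subset]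

theorem diffCount_eq_card_filter {A : ℕ → ℕ → ℕ} {S : Finset ℕ} {x y : ℕ} :
    diffCount A S x y = (S.filter fun z => A z x = 1 ∧ ¬ A z y = 1).card := by
  rw [diffCount]
  congr 1
  ext z
  simp only [Finset.mem_sdiff, mem_nbrs, Finset.mem_filter]
  tauto

theorem filter_take_succ (L : List ℕ) (p : ℕ → Prop) [DecidablePred p] (k : ℕ) :
    (L.take (k + 1)).filter p =
      if k < L.length ∧ p (L.getD k 0) then (L.take k).filter p ++ [L.getD k 0]
      else (L.take k).filter p := by
  by_cases hk : k < L.length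
  · rw [List.take_succ_eq_append_getElem hk, List.filter_append, List.getD_eq_getElem _ _ hk]
    by_cases hp : p L[k] <;> simp [hk, hp]
  · rw [if_neg (fun h => hk h.1), List.take_of_length_le (by omega),
      List.take_of_length_le (by omega)]

theorem getD_append_singleton (P : List ℕ) (x q : ℕ) :
    (P ++ [x]).getD q 0 = if q = P.length then x else P.getD q 0 := by
  simp only [List.getD_eq_getElem?_getD, List.getElem?_append, List.getElem?_singleton]
  split_ifs with h1 h2 h3 h3
  all_goals first | omega | simp_all

theorem getD_range' (n q : ℕ) : (List.range' 1 n).getD q 0 = if q < n then q + 1 else 0 := by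
  rw [List.getD_eq_getElem?_getD]
  split_ifs with h
  · rw [List.getElem?_range' h]
    simp [add_comm]
  · rw [List.getElem?_eq_none (by simpa using h)]
    rfl

theorem Runs.initArrays {s : State} {n : ℕ} (hn : s.reg regN = n) (hc : s.reg regCan = 1)
    (hL : ∀ r q, s.arr arrList r q = 0) :
    Runs initArrays (9 + (n + 1) * (8 + 10)) s fun s' =>
      (∀ a b, s'.arr arrAdj a b = if a = b ∧ 1 ≤ a ∧ a ≤ n then 1 else s.arr arrAdj a b) ∧
      (∀ r q, s'.arr arrList r q = if r = 1 ∧ 1 ≤ q ∧ q ≤ n then q else 0) := by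
  refine (Runs.forUp_all (a := 1) (T := 8) (I := fun k s' =>
      (∀ a b, s'.arr arrAdj a b = if a = b ∧ 1 ≤ a ∧ a < k then 1 else s.arr arrAdj a b) ∧
      (∀ r q, s'.arr arrList r q = if r = 1 ∧ 1 ≤ q ∧ q < k then q else 0)) rfl rfl rfl (by decide)
      (by decide) hn hc rfl (by omega) ⟨fun a b => ?_, fun r q => ?_⟩ ?_).mono
      (le_of_eq rfl) fun s' _ h => ?_
  · rw [if_neg (by omega)]; rfl
  · rw [if_neg (by omega)]; exact hL r q
  · intro k s₁ h1 h2 hx _ _ _ hI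
    refine Runs.seq 4 4 le_rfl (Runs.store (i := k) (j := k) (w := 1) le_rfl hx hx rfl ?_)
    refine Runs.store (i := 1) (j := k) (w := k) le_rfl rfl hx hx ⟨fun a b => ?_, fun r q => ?_⟩
    · simp only [State.setReg_arr, State.setArr_arr, hI.1, show arrAdj ≠ arrList by decide,
        false_and, true_and, if_false]
      by_cases h : a = k ∧ b = k
      · rw [if_pos h, if_pos (by omega)]
      · rw [if_neg h]
        refine if_congr ?_ rfl rfl
        omega
    · simp only [State.setReg_arr, State.setArr_arr, hI.2, show arrList ≠ arrAdj by decide,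
        false_and, true_and, if_false]
      by_cases h : r = 1 ∧ q = k
      · rw [if_pos h, if_pos (by omega), h.2]
      · rw [if_neg h]
        refine if_congr ?_ rfl rfl
        omega
  · simpa only [Nat.lt_succ_iff] using h

theorem Runs.countDiffs {s : State} {A : ℕ → ℕ → ℕ} {n : ℕ} (hn : s.reg regN = n)
    (hc : s.reg regCan = 1) (hA : s.arr arrAdj = A) (hD : ∀ a b, s.arr arrDiff a b = 0) :
    Runs countDiffs (9 + (n + 1) * (19 + (n + 1) * (9 + (n + 1) * 40 + 10))) s fun s' =>
      ∀ a b, s'.arr arrDiff a b =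
        if (1 ≤ a ∧ a ≤ n) ∧ b ≤ n then diffCount A (Finset.Icc 1 n) a b else 0 := by
  refine (Runs.forCells (B := arrDiff) (g := diffCount A (Finset.Icc 1 n)) (T := 9 + (n + 1) * 40)
    rfl rfl rfl rfl hn hc ?_).mono le_rfl fun s' _ h => by simpa only [hD] using h
  intro a b s₁ _ _ _ hx hy hp hab
  refine (Runs.forUp_all (a := 1) (T := 30) (I := fun k s' => ∀ a' b', s'.arr arrDiff a' b' =
      if a' = a ∧ b' = b then ((Finset.Ico 1 k).filter fun z => A z a = 1 ∧ ¬ A z b = 1).card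
      else s₁.arr arrDiff a' b') rfl rfl rfl (by decide) (by decide) ((hp.1 regN rfl).trans hn)
      ((hp.1 regCan rfl).trans hc) rfl (by omega) ?_ ?_).mono le_rfl ?_
  · intro a' b'
    simp only [State.setReg_arr]
    split_ifs with h
    · rw [h.1, h.2, hab, hD]; simp
    · rfl
  · intro k s₂ hk1 _ hz _ _ hp₂ hI
    have hx₂ := (hp₂.1 regX rfl).trans hx
    have hy₂ := (hp₂.1 regY rfl).trans hy
    have hA₂ : s₂.arr arrAdj = A := by rw [hp₂.2 arrAdj rfl, hp.2 arrAdj rfl, hA]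
    have hset : Finset.Ico 1 (k + 1) = insert k (Finset.Ico 1 k) := by
      ext z; simp only [Finset.mem_insert, Finset.mem_Ico]; omega
    have hk : k ∉ (Finset.Ico 1 k).filter fun z => A z a = 1 ∧ ¬ A z b = 1 := by simp
    refine Runs.branch 12 (by decide) (fun hb => ?_) fun hb => ?_
    all_goals
      simp only [Test.holds, adjacent, Expr.eval, hx₂, hy₂, hz, hA₂] at hb
    · refine Runs.store (i := a) (j := b)
        (w := ((Finset.Ico 1 k).filter fun z => A z a = 1 ∧ ¬ A z b = 1).card + 1) (by decide) hx₂ hy₂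
        ?_ fun a' b' => ?_
      · simp [Expr.eval, hx₂, hy₂, hI]
      · simp only [State.setReg_arr, State.setArr_arr, hI, true_and]
        rw [hset, Finset.filter_insert, if_pos hb, Finset.card_insert_of_notMem hk]
        split_ifs <;> rfl
    · refine Runs.skip (by decide) fun a' b' => ?_
      rw [hset, Finset.filter_insert, if_neg hb]
      exact hI a' b'
  · intro s' _ h a' b'
    rw [h, diffCount_eq_card_filter]
    rfl

/-- The sorting in round `i`, if row `i` of `arrList` holds `L` and `S` is the set of the vertices
left. -/
theorem Runs.sortRound {s : State} {A : ℕ → ℕ → ℕ} {n i : ℕ} {S : Finset ℕ} {L : List ℕ}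
    (hn : s.reg regN = n) (hc : s.reg regCan = 1) (hround : s.reg regRound = i)
    (hlen : L.length ≤ n) (hL : ∀ q, s.arr arrList i (q + 1) = L.getD q 0)
    (hpos : ∀ x ∈ L, s.arr arrPos 0 x = 0 ↔ x ∈ S)
    (hdeg : ∀ x ∈ L, s.arr arrDiff x 0 = (nbrs A S x).card) (hdeg0 : s.arr arrDiff 0 0 = 0)
    (hnew : ∀ q, s.arr arrList (i + 1) q = 0) :
    Runs sortRound (2 + (9 + (n + 1) * (9 + (n + 1) * 40 + 10))) s fun s' =>
      (∀ q, s'.arr arrList (i + 1) (q + 1) = (sortByDegree A n S L).getD q 0) ∧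
      ∀ r q, r ≠ i + 1 → s'.arr arrList r q = s.arr arrList r q := by
  -- The next row holds the list `P`, and `regFree` is its first free cell.
  let holdsList : List ℕ → State → Prop := fun P s' =>
    s'.reg regFree = P.length + 1 ∧ (∀ q, s'.arr arrList (i + 1) (q + 1) = P.getD q 0) ∧
      ∀ r q, r ≠ i + 1 → s'.arr arrList r q = s.arr arrList r q
  let f : ℕ → List ℕ := fun d => L.filter fun x => x ∈ S ∧ (nbrs A S x).card = d
  refine Runs.seq 2 (9 + (n + 1) * (9 + (n + 1) * 40 + 10)) le_rfl
    (Runs.assign (w := 1) le_rfl rfl ?_)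
  refine (Runs.forUp_all (a := 1) (T := 9 + (n + 1) * 40)
    (I := fun d s' => holdsList ((List.range' 1 (d - 1)).flatMap f) s') rfl rfl rfl (by decide)
    (by decide) (by simp [hn]) (by simp [hc]) rfl (by omega) ?_ ?_).mono le_rfl
    fun s' _ h => h.2
  · exact ⟨by simp, fun q => by simp [hnew], fun r q _ => rfl⟩
  intro d s₁ hd _ hx hn₁ hc₁ hp₁ hI₁
  refine (Runs.forUp_all (a := 1) (T := 30)
    (I := fun k s' => holdsList ((List.range' 1 (d - 1)).flatMap f ++
      (L.take (k - 1)).filter fun x => x ∈ S ∧ (nbrs A S x).card = d) s') rfl rfl rfl (by decide)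
    (by decide) hn₁ hc₁ rfl (by omega) ?_ ?_).mono le_rfl fun s' _ h => ?_
  · simpa [holdsList] using hI₁
  · intro k s₂ hk _ hy _ _ hp₂ hI₂
    obtain ⟨k, rfl⟩ := Nat.exists_eq_add_of_le' hk
    rw [Nat.add_sub_cancel] at hI₂ ⊢
    set P := (List.range' 1 (d - 1)).flatMap f ++
      (L.take k).filter fun x => x ∈ S ∧ (nbrs A S x).card = d with hP
    obtain ⟨hfree, hrow, hrows⟩ := hI₂
    have hround₂ : s₂.reg regRound = i := by
      rw [hp₂.1 regRound rfl, hp₁.1 regRound rfl]; simp [hround]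
    have hentry : listEntry.eval s₂ = L.getD k 0 := by
      simp only [listEntry, Expr.eval, hround₂, hy, hrows i _ (by omega), hL]
    have hpos₂ : s₂.arr arrPos = s.arr arrPos := by rw [hp₂.2 _ rfl, hp₁.2 _ rfl]; rfl
    have hdiff₂ : s₂.arr arrDiff = s.arr arrDiff := by rw [hp₂.2 _ rfl, hp₁.2 _ rfl]; rfl
    have hx₂ : s₂.reg regX = d := (hp₂.1 regX rfl).trans hx
    have htest : (Test.conj (.eq (.get arrPos (.lit 0) listEntry) (.lit 0))
        (.eq (.get arrDiff listEntry (.lit 0)) (.var regX))).holds s₂ ↔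
        k < L.length ∧ (L.getD k 0 ∈ S ∧ (nbrs A S (L.getD k 0)).card = d) := by
      simp only [Test.holds, Expr.eval, hentry, hpos₂, hdiff₂, hx₂]
      by_cases hkL : k < L.length
      · have hmem : L.getD k 0 ∈ L := by
          rw [List.getD_eq_getElem _ _ hkL]; exact List.getElem_mem hkL
        rw [hpos _ hmem, hdeg _ hmem]
        simp only [hkL, true_and]
      · rw [List.getD_eq_default _ _ (by omega), hdeg0]
        exact iff_of_false (by omega) (by tauto)
    have htake := filter_take_succ L (fun x => x ∈ S ∧ (nbrs A S x).card = d) k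
    refine Runs.branch 12 (by decide) (fun hb => ?_) fun hb => ?_
    · rw [htake, if_pos (htest.1 hb), ← List.append_assoc, ← hP]
      refine Runs.seq 7 3 (by decide) (Runs.store (i := i + 1) (j := P.length + 1) (by decide) ?_ hfree
        hentry (Runs.assign (w := P.length + 2) (by decide) ?_ ⟨?_, fun q => ?_, fun r q hr => ?_⟩))
      · simp [Expr.eval, hround₂]
      · simp [Expr.eval, hfree]
      · simp
      · simp only [State.setReg_arr, State.setArr_arr, getD_append_singleton, hrow,
          Nat.add_right_cancel_iff, true_and]
      · simp only [State.setReg_arr, State.setArr_arr, hrows r q hr, hr, false_and, and_false,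
          if_false]
    · rw [htake, if_neg (fun h => hb (htest.2 h))]
      refine Runs.skip (by decide) ⟨?_, hrow, hrows⟩
      rw [State.setReg_reg, if_neg (by decide)]
      exact hfree
  · obtain ⟨d, rfl⟩ := Nat.exists_eq_add_of_le' hd
    simp only [Nat.add_sub_cancel] at h
    rw [List.take_of_length_le hlen] at h
    have : (List.range' 1 (d + 1 + 1 - 1)).flatMap f =
        (List.range' 1 d).flatMap f ++ f (d + 1) := by
      rw [Nat.add_sub_cancel, List.range'_1_concat, List.flatMap_append, add_comm 1 d]
      simp
    rw [this]
    refine ⟨?_, h.2.1, h.2.2⟩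
    rw [State.setReg_reg, if_neg (by decide)]
    exact h.1

/-- The test of the vertex `v`. As `arrDiff` is zero in row `0`, the first neighbour of `v` in the
list passes the comparison with the initial value `0` of `regLast`. -/
theorem Runs.testSimple {s : State} {A : ℕ → ℕ → ℕ} {n i v : ℕ} {S : Finset ℕ} {L : List ℕ}
    (hn : s.reg regN = n) (hc : s.reg regCan = 1) (hround : s.reg regRound = i)
    (hcand : s.reg regCand = v) (hlen : L.length ≤ n)
    (hL : ∀ q, s.arr arrList (i + 1) (q + 1) = L.getD q 0) (hA : s.arr arrAdj = A)
    (hA0 : ∀ v, A v 0 ≠ 1)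
    (hD : ∀ x ∈ L, ∀ y ∈ L, s.arr arrDiff x y = 0 ↔ nbrs A S x ⊆ nbrs A S y)
    (hD0 : ∀ y ∈ L, s.arr arrDiff 0 y = 0) :
    Runs testSimple (2 + (2 + (9 + (n + 1) * 50))) s fun s' =>
      (s'.reg regOk = 1 ↔
        (L.filter fun x => A v x = 1).IsChain fun x y => nbrs A S x ⊆ nbrs A S y) := by
  -- The neighbours of `v` among the first `k` entries of the list.
  let P : ℕ → List ℕ := fun k => (L.take k).filter fun x => A v x = 1
  refine Runs.seq 2 (2 + (9 + (n + 1) * 50)) le_rfl (Runs.assign (w := 1) le_rfl rfl ?_)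
  refine Runs.seq 2 (9 + (n + 1) * 50) le_rfl (Runs.assign (w := 0) le_rfl rfl ?_)
  refine (Runs.forUp_all (a := 1) (T := 40) (I := fun k s' =>
      (s'.reg regOk = 1 ↔ (P (k - 1)).IsChain fun x y => nbrs A S x ⊆ nbrs A S y) ∧
      s'.reg regLast = (P (k - 1)).getLast?.getD 0) rfl rfl rfl (by decide) (by decide)
      (by simp [hn]) (by simp [hc]) rfl (by omega) ⟨?_, ?_⟩ ?_).mono le_rfl fun s' _ h => ?_
  · simp [P]
  · simp [P]
  · intro k s₁ hk _ hx _ _ hp hI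
    obtain ⟨k, rfl⟩ := Nat.exists_eq_add_of_le' hk
    rw [Nat.add_sub_cancel] at hI ⊢
    obtain ⟨hok, hlast⟩ := hI
    have harr : s₁.arr = s.arr := funext fun B => (hp.2 B rfl).trans rfl
    have hround₁ : s₁.reg regRound = i := by rw [hp.1 regRound rfl]; simp [hround]
    have hcand₁ : s₁.reg regCand = v := by rw [hp.1 regCand rfl]; simp [hcand]
    have hstep : P (k + 1) =
        if k < L.length ∧ A v (L.getD k 0) = 1 then P k ++ [L.getD k 0] else P k :=
      filter_take_succ L (fun x => A v x = 1) k
    refine Runs.seq 5 30 (by decide) (Runs.assign (w := L.getD k 0) (by decide) ?_ ?_)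
    · simp only [Expr.eval, hround₁, hx, harr, hL]
    refine Runs.branch 20 (by decide) (fun hb => ?_) fun hb => ?_
    all_goals
      simp only [Test.holds, adjacent, Expr.eval, State.setReg_reg, State.setReg_arr, harr, hA,
        if_true, show regCand ≠ regY by decide, if_false, hcand₁] at hb
    · have hkL : k < L.length := by
        by_contra hno
        rw [List.getD_eq_default _ _ (by omega)] at hb
        exact hA0 v hb
      have hmem : L.getD k 0 ∈ L := by
        rw [List.getD_eq_getElem _ _ hkL]; exact List.getElem_mem hkL
      rw [hstep, if_pos ⟨hkL, hb⟩]
      have hchain : (P k ++ [L.getD k 0]).IsChain (fun x y => nbrs A S x ⊆ nbrs A S y) ↔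
          (P k).IsChain (fun x y => nbrs A S x ⊆ nbrs A S y) ∧
            s.arr arrDiff ((P k).getLast?.getD 0) (L.getD k 0) = 0 := by
        rw [List.isChain_append]
        simp only [List.isChain_singleton, true_and, List.head?_cons, Option.mem_def,
          Option.some.injEq, forall_eq']
        refine and_congr_right fun _ => ?_
        rcases h : (P k).getLast? with _ | x
        · simp [hD0 _ hmem, -List.getD_eq_getElem?_getD]
        · have hxL : x ∈ L :=
            List.mem_of_mem_take (List.mem_of_mem_filter (List.mem_of_getLast? h))
          simp [hD x hxL _ hmem, -List.getD_eq_getElem?_getD]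
      refine Runs.seq 10 2 (by decide) (Runs.branch 2 (by decide) (fun h0 => ?_) fun h0 => ?_)
      all_goals
        simp only [Test.holds, Expr.eval, State.setReg_reg, State.setReg_arr, harr, if_true,
          show regLast ≠ regY by decide, if_false, hlast] at h0
      · refine Runs.skip (by decide) (Runs.assign (w := L.getD k 0) (by decide) ?_ ⟨?_, ?_⟩)
        · simp [Expr.eval]
        · rw [hchain, ← hok]
          simpa using fun _ => h0
        · simp
      · refine Runs.assign (w := 0) (by decide) rfl
          (Runs.assign (w := L.getD k 0) (by decide) ?_ ⟨?_, ?_⟩)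
        · simp [Expr.eval]
        · rw [hchain]
          simpa using fun _ => h0
        · simp
    · rw [hstep, if_neg (fun h => hb h.2)]
      refine Runs.skip (by decide) ⟨?_, ?_⟩
      · simpa using hok
      · simpa using hlast
  · have := h.1
    rwa [Nat.add_sub_cancel, show P n = L.filter fun x => A v x = 1 by
      simp only [P, List.take_of_length_le hlen]] at this

theorem Runs.chooseVertex {s : State} {A : ℕ → ℕ → ℕ} {n i : ℕ} {S : Finset ℕ} {L : List ℕ}
    (hn : s.reg regN = n) (hc : s.reg regCan = 1) (hround : s.reg regRound = i)
    (hlen : L.length ≤ n) (hL : ∀ q, s.arr arrList (i + 1) (q + 1) = L.getD q 0)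
    (hA : s.arr arrAdj = A) (hA0 : ∀ v, A v 0 ≠ 1)
    (hD : ∀ x ∈ L, ∀ y ∈ L, s.arr arrDiff x y = 0 ↔ nbrs A S x ⊆ nbrs A S y)
    (hD0 : ∀ y ∈ L, s.arr arrDiff 0 y = 0)
    (hsimple : ∀ v, IsSimple A S v ↔
      (L.filter fun x => A v x = 1).IsChain fun x y => nbrs A S x ⊆ nbrs A S y) :
    Runs chooseVertex (2 + (9 + (n + 1) * (40 + (n + 1) * 50 + 10))) s fun s' =>
      s'.reg regPick = firstSimple A S L := by
  refine Runs.seq 2 (9 + (n + 1) * (40 + (n + 1) * 50 + 10)) le_rfl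
    (Runs.assign (w := 0) le_rfl rfl ?_)
  refine (Runs.forDown (a := n) (T := 40 + (n + 1) * 50) (I := fun k s' =>
    s'.reg regPick = firstSimple A S (L.drop k)) rfl ?_ ?_ ?_).mono ?_ ?_
  · simp [Expr.eval, hn]
  · rw [List.drop_of_length_le hlen]
    simp [firstSimple]
  · intro k s₁ hk _ hz hc₁ hp hI
    obtain ⟨k, rfl⟩ := Nat.exists_eq_add_of_le' hk
    rw [Nat.add_sub_cancel]
    have harr : s₁.arr = s.arr := funext fun B => (hp.2 B rfl).trans rfl
    have hround₁ : s₁.reg regRound = i := by rw [hp.1 regRound rfl]; simp [hround]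
    have hn₁ : s₁.reg regN = n := by rw [hp.1 regN rfl]; simp [hn]
    refine Runs.seq 5 (2 + (2 + (9 + (n + 1) * 50)) + 7) (by omega)
      (Runs.assign (w := L.getD k 0) (by decide) ?_ ?_)
    · simp only [Expr.eval, hround₁, hz, harr, hL]
    refine Runs.seq (2 + (2 + (9 + (n + 1) * 50))) 7 le_rfl
      ((Runs.testSimple (s := s₁.setReg regCand (L.getD k 0)) (A := A) (i := i) (v := L.getD k 0)
        (S := S) (L := L) (by simp [hn₁]) (by simp [hc₁]) (by simp [hround₁]) (by simp) hlen
        (by simpa only [State.setReg_arr, harr] using hL) (by simp [harr, hA]) hA0 (by simpa [harr] using hD) (by simpa [harr] using hD0)).mono le_rfl ?_)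
    intro s₂ hp₂ hok
    rw [← hsimple] at hok
    have hpick₂ : s₂.reg regPick = firstSimple A S (L.drop (k + 1)) := by
      rw [hp₂.1 regPick rfl]
      simpa using hI
    have hcand₂ : s₂.reg regCand = L.getD k 0 := by rw [hp₂.1 regCand rfl]; simp
    have hnext : firstSimple A S (L.drop k) =
        if IsSimple A S (L.getD k 0) then L.getD k 0 else firstSimple A S (L.drop (k + 1)) := by
      by_cases hkL : k < L.length
      · rw [firstSimple, List.drop_eq_getElem_cons hkL, List.find?_cons,
          List.getD_eq_getElem _ _ hkL]
        by_cases h : IsSimple A S L[k] <;> simp [h, firstSimple]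
      · rw [List.drop_of_length_le (by omega), List.drop_of_length_le (by omega),
          List.getD_eq_default _ _ (by omega)]
        simp [firstSimple]
    refine Runs.branch 2 (by decide) (fun hb => ?_) fun hb => ?_
    all_goals
      simp only [Test.holds, Expr.eval, hok] at hb
    · refine Runs.assign (w := L.getD k 0) (by decide) hcand₂ ?_
      rw [hnext, if_pos hb]
      simp
    · refine Runs.skip (by decide) ?_
      rw [hnext, if_neg hb]
      simpa using hpick₂
  · simp only [Expr.cost]
    gcongr
    omega
  · -- All loops run to their ends, because `regCan` is not changed.
    rintro s' hp ⟨k, -, -, h1, h2⟩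
    have hc' : s'.reg regCan = 1 := by rw [hp.1 regCan rfl]; simp [hc]
    rcases h2 with rfl | h2
    · simpa using h1
    · exact absurd hc' h2

/-- The removal of the vertex `w` in round `i`: a cell of `arrDiff` loses one exactly if `w` was
counted there. -/
theorem Runs.removeVertex {s : State} {A : ℕ → ℕ → ℕ} {n i w : ℕ} {S : Finset ℕ}
    (hn : s.reg regN = n) (hc : s.reg regCan = 1) (hround : s.reg regRound = i)
    (hpick : s.reg regPick = w) (hw : w ∈ S) (hA : s.arr arrAdj = A)
    (hD : ∀ x y, x ≤ n → y ≤ n → s.arr arrDiff x y = diffCount A S x y)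
    (hA0 : ∀ v, A v 0 ≠ 1) :
    Runs removeVertex (4 + (4 + (9 + (n + 1) * (19 + (n + 1) * 50)))) s fun s' =>
      (∀ a b, s'.arr arrOrd a b = if a = 0 ∧ b = i then w else s.arr arrOrd a b) ∧
      (∀ a b, s'.arr arrPos a b = if a = 0 ∧ b = w then i else s.arr arrPos a b) ∧
      ∀ x y, x ≤ n → y ≤ n → s'.arr arrDiff x y = diffCount A (S.erase w) x y := by
  have herase : ∀ x y, diffCount A (S.erase w) x y =
      if A w x = 1 ∧ ¬ A w y = 1 then diffCount A S x y - 1 else diffCount A S x y := by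
    intro x y
    simp only [diffCount_eq_card_filter, Finset.filter_erase]
    split_ifs with h
    · rw [Finset.card_erase_of_mem]
      simp [hw, h]
    · rw [Finset.erase_eq_of_notMem]
      simp only [Finset.mem_filter, not_and_or]
      exact Or.inr (not_and_or.1 h)
  refine Runs.seq 4 (4 + (9 + (n + 1) * (19 + (n + 1) * 50))) le_rfl
    (Runs.store (i := 0) (j := i) (w := w) le_rfl rfl hround hpick ?_)
  refine Runs.seq 4 (9 + (n + 1) * (19 + (n + 1) * 50)) le_rfl
    (Runs.store (i := 0) (j := w) (w := i) le_rfl rfl hpick hround ?_)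
  refine (Runs.forCells (B := arrDiff) (g := diffCount A (S.erase w)) (T := 40) rfl rfl rfl rfl
    (by simp [hn]) (by simp [hc]) ?_).mono le_rfl ?_
  · intro a b s₁ _ han hbn hx hy hp hab
    have hA₁ : s₁.arr arrAdj = A := by
      rw [hp.2 arrAdj rfl, ← hA]
      ext a b
      simp
    have hpick₁ : s₁.reg regPick = w := by rw [hp.1 regPick rfl]; simp [hpick]
    simp only [State.setArr_arr, show arrDiff ≠ arrPos by decide, show arrDiff ≠ arrOrd by decide,
      false_and, if_false, hD a b han hbn] at hab
    refine Runs.branch 20 (by decide) (fun hb => ?_) fun hb => ?_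
    all_goals
      simp only [Test.holds, adjacent, Expr.eval, hx, hy, hpick₁, hA₁] at hb
    · refine Runs.store (i := a) (j := b) (w := diffCount A S a b - 1) (by decide) hx hy ?_
        fun a' b' => ?_
      · simp [Expr.eval, hx, hy, hab]
      · simp only [State.setArr_arr, true_and, herase a b, if_pos hb]
    · refine Runs.skip (by decide) fun a' b' => ?_
      rw [herase, if_neg hb]
      split_ifs with h
      · rw [h.1, h.2, hab]
      · rfl
  · intro s' hp h
    refine ⟨fun a b => ?_, fun a b => ?_, fun x y hx hy => ?_⟩
    · rw [hp.2 arrOrd rfl]; simp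
    · rw [hp.2 arrPos rfl]; simp
    · rw [h]
      split_ifs with hxy
      · rfl
      · obtain rfl : x = 0 := by omega
        have : ∀ S, diffCount A S 0 y = 0 := by
          intro S
          rw [diffCount_eq_card_filter, Finset.card_eq_zero, Finset.filter_eq_empty_iff]
          exact fun z _ h => hA0 z h.1
        simp [hD 0 y hx hy, this]

theorem Runs.fillMatrix {s : State} {n : ℕ} (hn : s.reg regN = n) (hc : s.reg regCan = 1) :
    Runs fillMatrix (9 + (n + 1) * (19 + (n + 1) * 30)) s fun s' =>
      ∀ a b, s'.arr arrM a b = if (1 ≤ a ∧ a ≤ n) ∧ b ≤ n then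
        s.arr arrAdj (s.arr arrOrd 0 a) (s.arr arrOrd 0 b) else s.arr arrM a b := by
  refine (Runs.forCells (B := arrM)
    (g := fun a b => s.arr arrAdj (s.arr arrOrd 0 a) (s.arr arrOrd 0 b)) (T := 20)
    rfl rfl rfl rfl hn hc ?_)
  intro a b s₁ _ _ _ hx hy hp _
  refine Runs.store (i := a) (j := b) (w := s.arr arrAdj (s.arr arrOrd 0 a) (s.arr arrOrd 0 b))
    (by decide) hx hy ?_ fun a' b' => ?_
  · simp only [Expr.eval, hx, hy, hp.2 arrAdj rfl, hp.2 arrOrd rfl]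
  · simp only [State.setArr_arr, true_and]

/-- The contents of the memory before round `k` of the main loop (the first round being `0`, for
which `regRound` is `1`). -/
structure RoundInvariant (A : ℕ → ℕ → ℕ) (n k : ℕ) (s : State) : Prop where
  diff : ∀ x y, x ≤ n → y ≤ n → s.arr arrDiff x y = diffCount A (alive A n k) x y
  row : ∀ q, s.arr arrList (k + 1) (q + 1) = (queue A n k).getD q 0
  rows : ∀ r q, k + 1 < r → s.arr arrList r q = 0
  pos : ∀ j < k, s.arr arrPos 0 (pick A n j) = j + 1
  pos_eq_zero : ∀ x, (∀ j < k, pick A n j ≠ x) → s.arr arrPos 0 x = 0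
  ord : ∀ j < k, s.arr arrOrd 0 (j + 1) = pick A n j
  ord_zero : s.arr arrOrd 0 0 = 0

theorem HasSimpleVertices.apply_zero_right {A : ℕ → ℕ → ℕ} {n : ℕ} (hA : HasSimpleVertices A n)
    (v : ℕ) : A v 0 ≠ 1 := by
  intro h
  rw [hA.symm] at h
  simpa using hA.mem 0 v h

theorem HasSimpleVertices.nbrs_zero {A : ℕ → ℕ → ℕ} {n : ℕ} (hA : HasSimpleVertices A n)
    (S : Finset ℕ) : nbrs A S 0 = ∅ := by
  rw [nbrs, Finset.filter_eq_empty_iff]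
  exact fun z _ => hA.apply_zero_right z

theorem Runs.round {A : ℕ → ℕ → ℕ} {n k : ℕ} {s : State} (hA : HasSimpleVertices A n)
    (hk : k < n) (hn : s.reg regN = n) (hc : s.reg regCan = 1) (hround : s.reg regRound = k + 1)
    (hAdj : s.arr arrAdj = A) (h : RoundInvariant A n k s) :
    Runs (.seq SCG.sortRound (.seq SCG.chooseVertex SCG.removeVertex))
      (500 * (n + 1) ^ 2) s (RoundInvariant A n (k + 1)) := by
  have hle : ∀ {x}, x ∈ Finset.Icc 1 n → x ≤ n := fun hx => (Finset.mem_Icc.1 hx).2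
  have hposAlive : ∀ x ∈ Finset.Icc 1 n, s.arr arrPos 0 x = 0 ↔ x ∈ alive A n k := by
    intro x hx
    rw [mem_alive]
    refine ⟨fun h0 => ⟨hx, fun j hj e => ?_⟩, fun hx => h.pos_eq_zero x hx.2⟩
    have := h.pos j hj
    rw [e] at this
    omega
  refine Runs.seq (2 + (9 + (n + 1) * (9 + (n + 1) * 40 + 10)))
    ((2 + (9 + (n + 1) * (40 + (n + 1) * 50 + 10))) +
      (4 + (4 + (9 + (n + 1) * (19 + (n + 1) * 50))))) (by nlinarith)
    ((Runs.sortRound (A := A) hn hc hround (length_queue_le hA.refl k) h.row (S := alive A n k) ?_ ?_ ?_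
      (fun q => h.rows _ q (by omega))).mono le_rfl ?_)
  · exact fun x hx => hposAlive x (queue_subset hA.refl hx)
  · intro x hx
    rw [h.diff x 0 (hle (queue_subset hA.refl hx)) (Nat.zero_le n), diffCount, hA.nbrs_zero,
      Finset.sdiff_empty]
  · rw [h.diff 0 0 (Nat.zero_le n) (Nat.zero_le n), diffCount_eq_zero]
  rintro s₁ hp₁ ⟨hrow₁, hrows₁⟩
  rw [← queue_succ] at hrow₁
  have hdiff₁ : ∀ x y, x ≤ n → y ≤ n →
      s₁.arr arrDiff x y = diffCount A (alive A n k) x y := by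
    rw [hp₁.2 arrDiff rfl]; exact h.diff
  have hAdj₁ : s₁.arr arrAdj = A := (hp₁.2 arrAdj rfl).trans hAdj
  refine Runs.seq _ _ le_rfl ((Runs.chooseVertex (i := k + 1) (S := alive A n k)
    ((hp₁.1 regN rfl).trans hn) ((hp₁.1 regCan rfl).trans hc) ((hp₁.1 regRound rfl).trans hround)
    (length_queue_le hA.refl (k + 1)) hrow₁ hAdj₁ hA.apply_zero_right ?_ ?_ ?_).mono le_rfl ?_)
  · intro x hx y hy
    rw [hdiff₁ x y (hle (queue_subset hA.refl hx)) (hle (queue_subset hA.refl hy)),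
      diffCount_eq_zero]
  · intro y hy
    rw [hdiff₁ 0 y (Nat.zero_le n) (hle (queue_subset hA.refl hy)), diffCount_eq_zero,
      hA.nbrs_zero]
    exact Finset.empty_subset _
  · exact isSimple_iff_isChain hA.symm (mem_queue_succ hA.refl k) (pairwise_card_queue_succ k)
  intro s₂ hp₂ hpick
  refine (Runs.removeVertex (i := k + 1) (S := alive A n k) ((hp₂.1 regN rfl).trans ((hp₁.1 regN rfl).trans hn))
    ((hp₂.1 regCan rfl).trans ((hp₁.1 regCan rfl).trans hc))
    ((hp₂.1 regRound rfl).trans ((hp₁.1 regRound rfl).trans hround)) hpick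
    (pick_mem_alive hA le_rfl hk) ((hp₂.2 arrAdj rfl).trans hAdj₁) (by rwa [hp₂.2 arrDiff rfl])
    hA.apply_zero_right).mono le_rfl ?_
  rintro s₃ hp₃ ⟨hord₃, hpos₃, hdiff₃⟩
  change ∀ a b, s₃.arr arrOrd a b = if a = 0 ∧ b = k + 1 then pick A n k else _ at hord₃
  change ∀ a b, s₃.arr arrPos a b = if a = 0 ∧ b = pick A n k then k + 1 else _ at hpos₃
  rw [hp₂.2 arrOrd rfl, hp₁.2 arrOrd rfl] at hord₃
  rw [hp₂.2 arrPos rfl, hp₁.2 arrPos rfl] at hpos₃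
  have hlist₃ : s₃.arr arrList = s₁.arr arrList := (hp₃.2 arrList rfl).trans (hp₂.2 arrList rfl)
  refine ⟨hdiff₃, by rwa [hlist₃], fun r q hr => ?_, fun j hj => ?_, fun x hx => ?_,
    fun j hj => ?_, ?_⟩
  · rw [hlist₃, hrows₁ r q (by omega), h.rows r q (by omega)]
  · rw [hpos₃]
    rcases Nat.lt_succ_iff_lt_or_eq.1 hj with hj | rfl
    · rw [if_neg (fun e => pick_ne_pick hA hj hk e.2), h.pos j hj]
    · simp
  · rw [hpos₃, if_neg (fun e => hx k (Nat.lt_succ_self k) e.2.symm)]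
    exact h.pos_eq_zero x fun j hj => hx j (Nat.lt_succ_of_lt hj)
  · rw [hord₃]
    rcases Nat.lt_succ_iff_lt_or_eq.1 hj with hj | rfl
    · rw [if_neg (by omega), h.ord j hj]
    · simp
  · rw [hord₃, if_neg (by omega), h.ord_zero]

/-- The preprocessing computes the order in which the vertices are eliminated, its inverse, and the
permuted matrix. -/
theorem Runs.preprocess {n : ℕ} {G : SimpleGraph (Fin n)} (hG : IsStronglyChordal G) :
    Runs SCG.preprocess (4000 * (n ^ 3 + 1)) (inputState G) fun s =>
      s.reg regN = n ∧ RoundInvariant (reflAdj G) n n s ∧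
      ∀ a b, s.arr arrM a b = if (1 ≤ a ∧ a ≤ n) ∧ b ≤ n then
        reflAdj G (s.arr arrOrd 0 a) (s.arr arrOrd 0 b) else 0 := by
  have hA := hasSimpleVertices_reflAdj hG
  have harr : ∀ B a b, B ≠ arrAdj → (inputState G).arr B a b = 0 := by
    intro B a b hB
    simp [inputState, hB]
  have hcost : 2 + ((9 + (n + 1) * (8 + 10)) +
      ((9 + (n + 1) * (19 + (n + 1) * (9 + (n + 1) * 40 + 10))) +
        ((9 + (n + 1) * (500 * (n + 1) ^ 2 + 10)) + (9 + (n + 1) * (19 + (n + 1) * 30))))) ≤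
      4000 * (n ^ 3 + 1) := by
    have h1 : (n + 1) ^ 3 ≤ 4 * (n ^ 3 + 1) := by
      zify
      nlinarith [mul_nonneg (show (0 : ℤ) ≤ n + 1 by positivity) (sq_nonneg ((n : ℤ) - 1))]
    have h2 : (n + 1) ^ 2 ≤ (n + 1) ^ 3 := Nat.pow_le_pow_right (by omega) (by omega)
    have h3 : (n + 1) ^ 1 ≤ (n + 1) ^ 3 := Nat.pow_le_pow_right (by omega) (by omega)
    have h4 : (n + 1) ^ 0 ≤ (n + 1) ^ 3 := Nat.pow_le_pow_right (by omega) (by omega)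
    nlinarith
  refine Runs.seq 2 _ hcost (Runs.assign (w := 1) le_rfl rfl ?_)
  refine Runs.seq _ _ le_rfl ((Runs.initArrays (n := n)
    (s := (inputState G).setReg regCan 1) (by simp [inputState]) (by simp)
    (fun r q => harr arrList r q (by decide))).mono le_rfl ?_)
  rintro s₁ hp₁ ⟨hAdj₁, hList₁⟩
  have hn₁ : s₁.reg regN = n := by rw [hp₁.1 regN rfl]; simp [inputState]
  have hc₁ : s₁.reg regCan = 1 := by rw [hp₁.1 regCan rfl]; simp
  have hzero₁ : ∀ B a b, SCG.initArrays.writesArr B = false → B ≠ arrAdj → s₁.arr B a b = 0 := by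
    intro B a b hB hB'
    rw [hp₁.2 B hB]
    exact harr B a b hB'
  have hAdj₁ : s₁.arr arrAdj = reflAdj G := by
    ext a b
    rw [hAdj₁]
    simp only [State.setReg_arr, inputState, reflAdj, true_and]
    by_cases h : a = b ∧ 1 ≤ a ∧ a ≤ n
    · obtain ⟨u, rfl⟩ := mem_Icc_iff_exists_fin.1 (Finset.mem_Icc.2 h.2)
      rw [if_pos h, if_pos ⟨u, u, mem_closedNbhd.2 (Or.inl rfl), rfl, h.1.symm⟩]
    · rw [if_neg h]
      congr 1
      refine propext ⟨?_, ?_⟩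
      · rintro ⟨-, u, v, huv, h1, h2⟩
        exact ⟨u, v, mem_closedNbhd.2 (Or.inr huv.symm), h1, h2⟩
      · rintro ⟨u, v, huv, rfl, rfl⟩
        rcases mem_closedNbhd.1 huv with rfl | huv
        · exact absurd ⟨rfl, by omega, by omega⟩ h
        · exact ⟨rfl, u, v, huv.symm, rfl, rfl⟩
  refine Runs.seq _ _ le_rfl ((Runs.countDiffs hn₁ hc₁ hAdj₁
    (fun a b => hzero₁ arrDiff a b rfl (by decide))).mono le_rfl ?_)
  intro s₂ hp₂ hDiff₂
  have hn₂ : s₂.reg regN = n := (hp₂.1 regN rfl).trans hn₁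
  have hc₂ : s₂.reg regCan = 1 := (hp₂.1 regCan rfl).trans hc₁
  have hAdj₂ : s₂.arr arrAdj = reflAdj G := (hp₂.2 arrAdj rfl).trans hAdj₁
  have hinv : RoundInvariant (reflAdj G) n 0 s₂ := by
    refine ⟨fun x y hx hy => ?_, fun q => ?_, fun r q hr => ?_, fun j hj => by omega,
      fun x _ => ?_, fun j hj => by omega, ?_⟩
    · rw [hDiff₂]
      split_ifs with hxy
      · rfl
      · obtain rfl : x = 0 := by omega
        rw [eq_comm, diffCount_eq_zero, hA.nbrs_zero]
        exact Finset.empty_subset _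
    · rw [hp₂.2 arrList rfl, hList₁]
      refine Eq.trans ?_ (getD_range' n q).symm
      exact if_congr (by omega) rfl rfl
    · rw [hp₂.2 arrList rfl, hList₁, if_neg (by omega)]
    · rw [hp₂.2 arrPos rfl, hzero₁ _ _ _ rfl (by decide)]
    · rw [hp₂.2 arrOrd rfl, hzero₁ _ _ _ rfl (by decide)]
  refine Runs.seq _ _ le_rfl ((Runs.forUp_all (a := 1) (T := 500 * (n + 1) ^ 2)
    (I := fun k s => RoundInvariant (reflAdj G) n (k - 1) s) rfl rfl rfl (by decide) (by decide)
    hn₂ hc₂ rfl (by omega) ?_ ?_).mono (le_of_eq rfl) ?_)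
  · exact ⟨hinv.1, hinv.2, hinv.3, hinv.4, hinv.5, hinv.6, hinv.7⟩
  · intro k s₃ hk1 hkn hround hn₃ hc₃ hp₃ hI₃
    obtain ⟨k, rfl⟩ := Nat.exists_eq_add_of_le' hk1
    refine (Runs.round hA (by omega) hn₃ hc₃ hround ((hp₃.2 arrAdj rfl).trans hAdj₂) hI₃).mono
      le_rfl fun s' _ h => ?_
    exact ⟨h.1, h.2, h.3, h.4, h.5, h.6, h.7⟩
  intro s₃ hp₃ hI₃
  refine ((Runs.fillMatrix ((hp₃.1 regN rfl).trans hn₂) ((hp₃.1 regCan rfl).trans hc₂)).mono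
    le_rfl ?_)
  intro s₄ hp₄ hM
  have hord : s₄.arr arrOrd = s₃.arr arrOrd := hp₄.2 arrOrd rfl
  refine ⟨(hp₄.1 regN rfl).trans ((hp₃.1 regN rfl).trans hn₂), ?_, fun a b => ?_⟩
  · have hpos : s₄.arr arrPos = s₃.arr arrPos := hp₄.2 arrPos rfl
    have hlist : s₄.arr arrList = s₃.arr arrList := hp₄.2 arrList rfl
    have hdiff : s₄.arr arrDiff = s₃.arr arrDiff := hp₄.2 arrDiff rfl
    exact ⟨by rw [hdiff]; exact hI₃.diff, by rw [hlist]; exact hI₃.row,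
      by rw [hlist]; exact hI₃.rows, by rw [hpos]; exact hI₃.pos,
      by rw [hpos]; exact hI₃.pos_eq_zero, by rw [hord]; exact hI₃.ord,
      by rw [hord]; exact hI₃.ord_zero⟩
  · rw [hM, hord, hp₃.2 arrAdj rfl, hAdj₂, hp₃.2 arrM rfl, hp₂.2 arrM rfl,
      hzero₁ arrM a b rfl (by decide)]

theorem preprocess_spec {n : ℕ} {G : SimpleGraph (Fin n)} (hG : IsStronglyChordal G) :
    ∃ (t : ℕ) (s : State) (α : Fin n ≃ Fin n),
      Exec preprocess (inputState G) t s ∧ t ≤ 4000 * (n ^ 3 + 1) ∧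
      IsStrongElimOrdering G α ∧ Represents G α s := by
  have hA := hasSimpleVertices_reflAdj hG
  obtain ⟨t, s, hexec, ht, hn, hinv, hM⟩ := Runs.preprocess hG
  have hfin : ∀ i : Fin n, ∃ u : Fin n, u.val + 1 = pick (reflAdj G) n i := fun i =>
    mem_Icc_iff_exists_fin.1 (alive_subset i (pick_mem_alive hA le_rfl i.isLt))
  choose f hf using hfin
  have hinj : Function.Injective f := by
    intro i j hij
    have hpick : pick (reflAdj G) n i = pick (reflAdj G) n j := by rw [← hf, ← hf, hij]
    rcases lt_trichotomy i j with h | h | h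
    · exact absurd hpick (pick_ne_pick hA h j.isLt)
    · exact h
    · exact absurd hpick.symm (pick_ne_pick hA h i.isLt)
  let α : Fin n ≃ Fin n := Equiv.ofBijective f (Finite.injective_iff_bijective.1 hinj)
  have hα : ∀ i, (α i).val + 1 = pick (reflAdj G) n i := hf
  have hadj : ∀ i j : Fin n, reflAdj G (pick (reflAdj G) n i) (pick (reflAdj G) n j) = 1 ↔
      α i ∈ closedNbhd G (α j) := by
    intro i j
    rw [← hα, ← hα, reflAdj_eq_one]
  have hord : ∀ i : Fin n, s.arr arrOrd 0 (i.val + 1) = pick (reflAdj G) n i := fun i =>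
    hinv.ord i i.isLt
  refine ⟨t, s, α, hexec, ht, ?_, hn, fun i => ?_, fun v => ?_, fun i j => ?_, fun a b hab => ?_⟩
  · intro i j k l hij hkl h1 h2 h3
    rw [← hadj] at h1 h2 h3 ⊢
    exact pick_strong hA hij hkl j.isLt l.isLt h1 h2 h3
  · rw [hord, hα]
  · have := hinv.pos (α.symm v) (α.symm v).isLt
    rwa [← hα, Equiv.apply_symm_apply] at this
  · rw [hM, if_pos (by omega), hord, hord]
    by_cases h : α i ∈ closedNbhd G (α j)
    · rw [(hadj i j).2 h, nbhdMatrix_eq_one.2 h]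
    · rw [nbhdMatrix_eq_zero.2 h]
      exact reflAdj_eq_zero (mt (hadj i j).1 h)
  · rw [hM]
    split_ifs with h
    · obtain rfl : b = 0 := by omega
      rw [hinv.ord_zero]
      exact reflAdj_eq_zero (hA.apply_zero_right _)
    · rfl

end SCG

theorem mainTheorem4 :
    -- strong elimination orderings are the orderings for which `M(G)` has no `Δ`
    (∀ (n : ℕ) (G : SimpleGraph (Fin n)) (α : Fin n ≃ Fin n),
      SCG.IsStrongElimOrdering G α ↔ ¬ SCG.HasDelta (SCG.nbhdMatrix G α)) ∧
    -- Farber: strongly chordal if and only if `M(G)` is totally balanced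
    (∀ (n : ℕ) (G : SimpleGraph (Fin n)) (α : Fin n ≃ Fin n),
      SCG.IsStronglyChordal G ↔ SCG.IsTotallyBalanced (SCG.nbhdMatrix G α)) ∧
    -- the insertion criterion
    (∀ (n : ℕ) (G : SimpleGraph (Fin n)) (α : Fin n ≃ Fin n) (u v : Fin n), u ≠ v →
      SCG.nbhdMatrix (G ⊔ SimpleGraph.edge u v) α =
        SCG.setEntry (SCG.nbhdMatrix G α) (α.symm u) (α.symm v) ∧
      (¬ SCG.HasDelta (SCG.setEntry (SCG.nbhdMatrix G α) (α.symm u) (α.symm v)) →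
        SCG.IsStrongElimOrdering (G ⊔ SimpleGraph.edge u v) α ∧
        SCG.IsStronglyChordal (G ⊔ SimpleGraph.edge u v))) ∧
    -- preprocessing in time `O(n³)`
    (∃ (pre : SCG.Prog) (c : ℕ), ∀ (n : ℕ) (G : SimpleGraph (Fin n)), SCG.IsStronglyChordal G →
      ∃ (t : ℕ) (s : SCG.State) (α : Fin n ≃ Fin n),
        SCG.Exec pre (SCG.inputState G) t s ∧ t ≤ c * (n ^ 3 + 1) ∧
        SCG.IsStrongElimOrdering G α ∧ SCG.Represents G α s) ∧
    -- Insert-Query in time `O(n²)`, the update in constant time, and Insert as a whole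
    (∃ c : ℕ, ∀ (n : ℕ) (G : SimpleGraph (Fin n)) (α : Fin n ≃ Fin n) (u v : Fin n)
      (s : SCG.State), SCG.IsStrongElimOrdering G α → u ≠ v → SCG.Represents G α s →
      s.reg SCG.regU = u.val + 1 → s.reg SCG.regV = v.val + 1 →
      ∃ (t₁ t₂ : ℕ) (s₁ s₂ : SCG.State),
        SCG.Exec SCG.insertQuery s t₁ s₁ ∧ t₁ ≤ c * n ^ 2 ∧
        SCG.Exec SCG.updateMatrix s₁ t₂ s₂ ∧ t₂ ≤ c ∧
        SCG.Exec SCG.insertEdge s (t₁ + t₂) s₂ ∧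
        SCG.Represents G α s₁ ∧
        ((¬ G.Adj u v ∧
            ¬ SCG.HasDelta (SCG.setEntry (SCG.nbhdMatrix G α) (α.symm u) (α.symm v)) ∧
            s₁.reg SCG.regCan = 1 ∧
            SCG.IsStrongElimOrdering (G ⊔ SimpleGraph.edge u v) α ∧
            SCG.IsStronglyChordal (G ⊔ SimpleGraph.edge u v) ∧
            SCG.Represents (G ⊔ SimpleGraph.edge u v) α s₂) ∨
          ((G.Adj u v ∨
              SCG.HasDelta (SCG.setEntry (SCG.nbhdMatrix G α) (α.symm u) (α.symm v))) ∧
            s₁.reg SCG.regCan = 0 ∧ SCG.Represents G α s₂))) := by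
  refine ⟨fun n G α => SCG.isStrongElimOrdering_iff_not_hasDelta,
    fun n G α => ⟨SCG.isTotallyBalanced_of_isStronglyChordal α,
      SCG.isStronglyChordal_of_isTotallyBalanced⟩,
    fun n G α u v huv => ⟨SCG.nbhdMatrix_sup_edge G α huv, fun h => ?_⟩,
    ⟨SCG.preprocess, 4000, fun n G hG => SCG.preprocess_spec hG⟩,
    ⟨1000, fun n G α u v s hα huv hs hu hv => SCG.insertEdge_spec hα huv hs hu hv⟩⟩
  exact ⟨SCG.isStrongElimOrdering_sup_edge huv h,
    ⟨n, α, SCG.isStrongElimOrdering_sup_edge huv h⟩⟩
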